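/- Let $X$ be a compact topological manifold, with or without boundary (Hausdorff, second countable, of some dimension $n\ge 0$, not necessarily connected or orientable), such that the singular homology group $H_1(X;\mathbb Z/2)$ is isomorphic to $\mathbb Z/2$. Let $\ell\to X$ be a bundle of infinite cyclic groups: each fibre $\ell_x$ is a group, and every point of $X$ has a neighbourhood $U$ with a homeomorphism $\ell|_U\cong U\times\mathbb Z$ over $U$ ($\mathbb Z$ discrete) that is a group isomorphism on each fibre. Assume that $\ell$ is non-trivial, i.e. not isomorphic to the product bundle $X\times\mathbb Z$. Let $H_*(X;\ell)$ and $H^*(X;\ell)$ denote singular homology and cohomology with $\ell$ as bundle of coefficients: chains are finite sums of lifts of singular simplices to $\ell$ (lifts of the same simplex being added fibrewise), and a cochain assigns to each singular simplex a lift of it to $\ell$. Then $H_1(X;\ell)$ is a finite group of odd order, and $H^2(X;\ell)$ contains no $2$-torsion, i.e. the only $x\in H^2(X;\ell)$ with $2x=0$ is $x=0$. -/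

import Mathlib

open CategoryTheory Opposite Topology

universe u

noncomputable section

/-! ### Manifolds with boundary -/

/-- The closed half-space `{x ∈ ℝⁿ : x₀ ≥ 0}`, for `n = 0` the one-point space `ℝ⁰`. A Hausdorff,
second countable space charted on it is a topological `n`-manifold, with or without boundary. -/
abbrev ClosedHalfSpace (n : ℕ) : Type :=
  {x : EuclideanSpace ℝ (Fin n) // ∀ i : Fin n, i.val = 0 → 0 ≤ x i}

/-! ### Bundles of discrete abelian groups -/

/-- A bundle over `X` of discrete abelian groups with fibre `G`: a group `fiber x` for each
`x : X` and a topology on the total space, such that over a neighbourhood of each point there is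
a local trivialization which is a group isomorphism onto `G` on each fibre. -/
structure GroupBundle (G : Type*) [AddCommGroup G] [TopologicalSpace G] [DiscreteTopology G]
    (X : Type u) [TopologicalSpace X] where
  /-- The fibres. -/
  fiber : X → Type u
  /-- The group structure of the fibres. -/
  [addCommGroup : ∀ x, AddCommGroup (fiber x)]
  /-- The topology of the total space. -/
  [topology : TopologicalSpace (Bundle.TotalSpace G fiber)]
  locally_trivial : ∀ x : X,
    ∃ e : Bundle.Trivialization G (Bundle.TotalSpace.proj : Bundle.TotalSpace G fiber → X),
      x ∈ e.baseSet ∧ ∀ y ∈ e.baseSet, ∀ a b : fiber y,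
        (e ⟨y, a + b⟩).2 = (e ⟨y, a⟩).2 + (e ⟨y, b⟩).2

namespace GroupBundle

variable {G : Type*} [AddCommGroup G] [TopologicalSpace G] [DiscreteTopology G]
  {X : Type u} [TopologicalSpace X] (E : GroupBundle G X)

attribute [instance] GroupBundle.addCommGroup GroupBundle.topology

/-- The total space of a bundle of groups. -/
abbrev Total : Type u := Bundle.TotalSpace G E.fiber

/-- The projection of a bundle of groups. -/
abbrev proj : E.Total → X := Bundle.TotalSpace.proj

/-- A bundle of groups is trivial if it is isomorphic to the product bundle `X × G → X`. -/
def IsTrivial : Prop :=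
  ∃ e : Bundle.Trivialization G E.proj, e.baseSet = Set.univ ∧
    ∀ y : X, ∀ a b : E.fiber y, (e ⟨y, a + b⟩).2 = (e ⟨y, a⟩).2 + (e ⟨y, b⟩).2

theorem isCoveringMap : IsCoveringMap E.proj := by
  intro x
  obtain ⟨e, hx, -⟩ := E.locally_trivial x
  exact (IsEvenlyCovered.of_trivialization hx).to_isEvenlyCovered_preimage

theorem continuousAt_iff {A : Type*} [TopologicalSpace A] (σ : C(A, X))
    (s : ∀ a, E.fiber (σ a)) (a₀ : A) (e : Bundle.Trivialization G E.proj)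
    (h : σ a₀ ∈ e.baseSet) :
    ContinuousAt (fun a => (⟨σ a, s a⟩ : E.Total)) a₀ ↔
      ContinuousAt (fun a => (e ⟨σ a, s a⟩).2) a₀ := by
  have hU : ∀ᶠ a in 𝓝 a₀, σ a ∈ e.baseSet :=
    σ.continuous.continuousAt.eventually (e.open_baseSet.mem_nhds h)
  have h1 : (fun a => (⟨σ a, s a⟩ : E.Total)) ⁻¹' e.source ∈ 𝓝 a₀ := by
    filter_upwards [hU] with a ha
    exact e.mem_source.2 ha
  rw [e.toOpenPartialHomeomorph.continuousAt_iff_continuousAt_comp_left h1]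
  constructor
  · intro hc
    exact continuous_snd.continuousAt.comp hc
  · intro hc
    refine (σ.continuous.continuousAt.prodMk hc).congr ?_
    filter_upwards [hU] with a ha
    have hs : (⟨σ a, s a⟩ : E.Total) ∈ e.source := e.mem_source.2 ha
    exact Prod.ext (e.coe_fst hs).symm rfl

/-! ### Lifts of a map to the total space -/

/-- The group of continuous lifts to the total space of a map `σ : A → X`, under pointwise
addition. A lift is given by its values `s a ∈ E_{σ a}`. -/
def lifts {A : Type*} [TopologicalSpace A] (σ : C(A, X)) :
    AddSubgroup (∀ a, E.fiber (σ a)) where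
  carrier := {s | Continuous fun a => (⟨σ a, s a⟩ : E.Total)}
  zero_mem' := by
    refine continuous_iff_continuousAt.2 fun a₀ => ?_
    obtain ⟨e, hx, he⟩ := E.locally_trivial (σ a₀)
    refine (E.continuousAt_iff σ _ a₀ e hx).2 ?_
    refine (continuousAt_const (y := (0 : G))).congr ?_
    filter_upwards [σ.continuous.continuousAt.eventually (e.open_baseSet.mem_nhds hx)] with a ha
    have h0 := he _ ha 0 0
    rw [add_zero] at h0
    exact (left_eq_add.1 h0).symm
  add_mem' := by
    intro s t hs ht
    refine continuous_iff_continuousAt.2 fun a₀ => ?_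
    obtain ⟨e, hx, he⟩ := E.locally_trivial (σ a₀)
    refine (E.continuousAt_iff σ _ a₀ e hx).2 ?_
    have h1 := (E.continuousAt_iff σ _ a₀ e hx).1 (continuous_iff_continuousAt.1 hs a₀)
    have h2 := (E.continuousAt_iff σ _ a₀ e hx).1 (continuous_iff_continuousAt.1 ht a₀)
    refine (h1.add h2).congr ?_
    filter_upwards [σ.continuous.continuousAt.eventually (e.open_baseSet.mem_nhds hx)] with a ha
    exact (he _ ha _ _).symm
  neg_mem' := by
    intro s hs
    refine continuous_iff_continuousAt.2 fun a₀ => ?_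
    obtain ⟨e, hx, he⟩ := E.locally_trivial (σ a₀)
    refine (E.continuousAt_iff σ _ a₀ e hx).2 ?_
    have h1 := (E.continuousAt_iff σ _ a₀ e hx).1 (continuous_iff_continuousAt.1 hs a₀)
    refine h1.neg.congr ?_
    filter_upwards [σ.continuous.continuousAt.eventually (e.open_baseSet.mem_nhds hx)] with a ha
    have h0 := he _ ha 0 0
    rw [add_zero] at h0
    have h3 := he _ ha (s a) (-s a)
    rw [add_neg_cancel, left_eq_add.1 h0] at h3
    exact (eq_neg_of_add_eq_zero_right h3.symm).symm

/-- Restriction of lifts of `σ` along a map `g`. -/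
def restrict {A B : Type*} [TopologicalSpace A] [TopologicalSpace B] (σ : C(B, X)) (g : C(A, B)) :
    E.lifts σ →+ E.lifts (σ.comp g) where
  toFun s := ⟨fun a => s.1 (g a), Continuous.comp (g := fun b => (⟨σ b, s.1 b⟩ : E.Total))
    s.2 g.continuous⟩
  map_zero' := rfl
  map_add' _ _ := rfl

/-- Two lifts over a connected space which agree at a point are equal. -/
theorem lifts_ext {A : Type*} [TopologicalSpace A] [PreconnectedSpace A] (σ : C(A, X))
    (s t : E.lifts σ) (a₀ : A) (h : s.1 a₀ = t.1 a₀) : s = t := by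
  have h1 := E.isCoveringMap.eq_of_comp_eq (g₁ := fun a => (⟨σ a, s.1 a⟩ : E.Total))
    (g₂ := fun a => (⟨σ a, t.1 a⟩ : E.Total)) s.2 t.2 rfl a₀ (by rw [h])
  refine Subtype.ext (funext fun a => ?_)
  have h2 := congrFun h1 a
  simpa using h2

/-- Over a space which contracts to the point `a₀`, there is a lift with any given value
at `a₀`. -/
theorem exists_lift {A : Type*} [TopologicalSpace A] (σ : C(A, X)) (a₀ : A) (v : E.fiber (σ a₀))
    (H : C(unitInterval × A, A)) (h0 : ∀ a, H (0, a) = a₀) (h1 : ∀ a, H (1, a) = a)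
    (ha₀ : ∀ t, H (t, a₀) = a₀) : ∃ s : E.lifts σ, s.1 a₀ = v := by
  let c : C(A, E.Total) := .const A ⟨σ a₀, v⟩
  have hc : ∀ a, (σ.comp H) (0, a) = E.proj (c a) := fun a => by simp [c, h0]
  let F := E.isCoveringMap.liftHomotopy (σ.comp H) c hc
  have hF : ∀ t a, E.proj (F (t, a)) = σ (H (t, a)) := fun t a =>
    congrFun (E.isCoveringMap.liftHomotopy_lifts (σ.comp H) c hc) (t, a)
  have hF0 : F (0, a₀) = ⟨σ a₀, v⟩ := E.isCoveringMap.liftHomotopy_zero (σ.comp H) c hc a₀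
  have hF1 : F (1, a₀) = ⟨σ a₀, v⟩ := by
    rw [← hF0]
    refine E.isCoveringMap.const_of_comp (g := fun t : unitInterval => F (t, a₀)) (by fun_prop) ?_ 1 0
    intro t t'
    rw [hF, hF, ha₀, ha₀]
  have hp : ∀ a, (F (1, a)).proj = σ a := fun a => by rw [← h1 a, ← hF 1 a, h1 a]
  have key : ∀ a, (⟨σ a, hp a ▸ (F (1, a)).2⟩ : E.Total) = F (1, a) := by
    intro a
    generalize_proofs h
    revert h
    generalize F (1, a) = w
    generalize σ a = x
    rintro rfl
    rfl
  refine ⟨⟨fun a => hp a ▸ (F (1, a)).2, ?_⟩, ?_⟩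
  · change Continuous fun a => (⟨σ a, hp a ▸ (F (1, a)).2⟩ : E.Total)
    simp_rw [key]
    fun_prop
  · have h2 := (key a₀).trans hF1
    simpa using h2

end GroupBundle

/-! ### Singular simplices -/

/-- The standard topological `n`-simplex. -/
abbrev TopSimplex (n : SimplexCategory) : Type := stdSimplex ℝ (Fin (n.len + 1))

/-- The affine map of standard simplices given by a monotone map of the vertices. -/
def TopSimplex.map {m n : SimplexCategory} (θ : m ⟶ n) : C(TopSimplex m, TopSimplex n) :=
  ⟨stdSimplex.map θ, stdSimplex.continuous_map θ⟩

theorem TopSimplex.map_id (n : SimplexCategory) : map (𝟙 n) = ContinuousMap.id (TopSimplex n) := by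
  ext1 x
  exact stdSimplex.map_id_apply x

theorem TopSimplex.map_comp {k m n : SimplexCategory} (η : k ⟶ m) (θ : m ⟶ n) :
    map (η ≫ θ) = (map θ).comp (map η) := by
  ext1 x
  exact (stdSimplex.map_comp_apply η θ x).symm

/-- The contraction of a simplex to one of its points along line segments. -/
def TopSimplex.contract {n : SimplexCategory} (a₀ : TopSimplex n) :
    C(unitInterval × TopSimplex n, TopSimplex n) where
  toFun p := ⟨(1 - p.1.1) • a₀.1 + p.1.1 • p.2.1,
    convex_stdSimplex ℝ _ a₀.2 p.2.2 (by linarith [p.1.2.2]) p.1.2.1 (by ring)⟩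
  continuous_toFun := by fun_prop

namespace GroupBundle

variable {G : Type*} [AddCommGroup G] [TopologicalSpace G] [DiscreteTopology G]
  {X : Type u} [TopologicalSpace X] (E : GroupBundle G X)

/-- Every lift of the restriction of a singular simplex to a face (or degeneracy) extends
uniquely to the whole simplex. -/
theorem restrict_bijective {m n : SimplexCategory} (τ : C(TopSimplex n, X))
    (g : C(TopSimplex m, TopSimplex n)) : Function.Bijective (E.restrict τ g) := by
  let a : TopSimplex m := Classical.arbitrary _
  constructor
  · intro s t h
    exact E.lifts_ext τ s t (g a) (congrFun (congrArg Subtype.val h) a)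
  · intro r
    obtain ⟨s, hs⟩ := E.exists_lift τ (g a) (r.1 a) (TopSimplex.contract (g a))
      (fun x => Subtype.ext (by simp [TopSimplex.contract]))
      (fun x => Subtype.ext (by simp [TopSimplex.contract]))
      (fun t => Subtype.ext (by simp [TopSimplex.contract, ← add_smul]))
    exact ⟨s, E.lifts_ext (τ.comp g) _ _ a hs⟩

/-- Restriction of lifts of a singular simplex, as an isomorphism. -/
def restrictEquiv {m n : SimplexCategory} (τ : C(TopSimplex n, X))
    (g : C(TopSimplex m, TopSimplex n)) : E.lifts τ ≃+ E.lifts (τ.comp g) :=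
  AddEquiv.ofBijective (E.restrict τ g) (E.restrict_bijective τ g)

/-! ### Singular chains with values in a bundle of groups -/

/-- Singular `n`-chains with values in `E`: finite formal sums of lifts to `E` of singular
`n`-simplices of `X`, where lifts of the same singular simplex are added in the fibres of `E`. -/
abbrev Chains (n : SimplexCategory) : Type u :=
  Π₀ σ : C(TopSimplex n, X), E.lifts σ

open Classical in
/-- The chain given by one lift `s` of a singular simplex `σ`. -/
def simplexChain {n : SimplexCategory} (σ : C(TopSimplex n, X)) : E.lifts σ →+ E.Chains n :=
  DFinsupp.singleAddHom (fun σ : C(TopSimplex n, X) => E.lifts σ) σ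

open Classical in
/-- Precomposition of lifted singular simplices with a map of standard simplices. -/
def chainsMap {m n : SimplexCategory} (g : C(TopSimplex m, TopSimplex n)) :
    E.Chains n →+ E.Chains m :=
  DFinsupp.liftAddHom fun σ => (E.simplexChain (σ.comp g)).comp (E.restrict σ g)

open Classical in
theorem chainsMap_simplexChain {m n : SimplexCategory} (g : C(TopSimplex m, TopSimplex n))
    (σ : C(TopSimplex n, X)) (s : E.lifts σ) :
    E.chainsMap g (E.simplexChain σ s) = E.simplexChain (σ.comp g) (E.restrict σ g s) := by
  simp [chainsMap, simplexChain]

open Classical in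
theorem chains_hom_ext {n : SimplexCategory} {M : Type*} [AddCommGroup M] {f g : E.Chains n →+ M}
    (h : ∀ σ s, f (E.simplexChain σ s) = g (E.simplexChain σ s)) : f = g :=
  DFinsupp.addHom_ext h

theorem chainsMap_id (n : SimplexCategory) :
    E.chainsMap (ContinuousMap.id (TopSimplex n)) = AddMonoidHom.id _ :=
  E.chains_hom_ext fun σ s => E.chainsMap_simplexChain _ σ s

theorem chainsMap_comp {k m n : SimplexCategory} (h : C(TopSimplex k, TopSimplex m))
    (g : C(TopSimplex m, TopSimplex n)) :
    E.chainsMap (g.comp h) = (E.chainsMap h).comp (E.chainsMap g) :=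
  E.chains_hom_ext fun σ s => by
    rw [AddMonoidHom.comp_apply, chainsMap_simplexChain, chainsMap_simplexChain,
      chainsMap_simplexChain]
    rfl

/-- The simplicial abelian group of singular chains with values in `E`. -/
def simplicialChains : SimplicialObject AddCommGrpCat.{u} where
  obj n := AddCommGrpCat.of (E.Chains n.unop)
  map θ := AddCommGrpCat.ofHom (E.chainsMap (TopSimplex.map θ.unop))
  map_id n := by
    rw [unop_id, TopSimplex.map_id, chainsMap_id]
    rfl
  map_comp θ η := by
    rw [unop_comp, TopSimplex.map_comp, chainsMap_comp]
    rfl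

/-- The singular chain complex `C_*(X; E)`; the boundary operator is the alternating sum of the
restrictions of lifts to the faces. -/
def chainComplex : ChainComplex AddCommGrpCat.{u} ℕ :=
  (AlgebraicTopology.alternatingFaceMapComplex AddCommGrpCat.{u}).obj E.simplicialChains

/-- The homology group `H_n(X; E)`. -/
def homology (n : ℕ) : AddCommGrpCat.{u} := E.chainComplex.homology n

/-! ### Singular cochains with values in a bundle of groups -/

/-- Singular `n`-cochains with values in `E`: functions which assign to each singular
`n`-simplex of `X` a lift of it to `E`. -/
abbrev Cochains (n : SimplexCategory) : Type u :=
  ∀ σ : C(TopSimplex n, X), E.lifts σ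

/-- The value on `τ` of the image of a cochain `φ` is the unique lift of `τ` which extends the
lift `φ (τ ∘ g)` of `τ ∘ g`. -/
def cochainsMap {m n : SimplexCategory} (g : C(TopSimplex m, TopSimplex n)) :
    E.Cochains m →+ E.Cochains n where
  toFun φ τ := (E.restrictEquiv τ g).symm (φ (τ.comp g))
  map_zero' := by
    funext τ
    exact map_zero (E.restrictEquiv τ g).symm
  map_add' φ ψ := by
    funext τ
    exact map_add (E.restrictEquiv τ g).symm _ _

theorem restrict_cochainsMap {m n : SimplexCategory} (g : C(TopSimplex m, TopSimplex n))
    (φ : E.Cochains m) (τ : C(TopSimplex n, X)) :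
    E.restrict τ g (E.cochainsMap g φ τ) = φ (τ.comp g) :=
  (E.restrictEquiv τ g).apply_symm_apply _

theorem cochainsMap_id (n : SimplexCategory) :
    E.cochainsMap (ContinuousMap.id (TopSimplex n)) = AddMonoidHom.id _ := by
  ext1 φ
  funext τ
  exact E.restrict_cochainsMap (ContinuousMap.id _) φ τ

theorem cochainsMap_comp {k m n : SimplexCategory} (h : C(TopSimplex k, TopSimplex m))
    (g : C(TopSimplex m, TopSimplex n)) :
    E.cochainsMap (g.comp h) = (E.cochainsMap g).comp (E.cochainsMap h) := by
  ext1 φ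
  funext τ
  refine (E.restrict_bijective τ (g.comp h)).1 ?_
  rw [restrict_cochainsMap]
  change φ _ = E.restrict (τ.comp g) h (E.restrict τ g (E.cochainsMap g (E.cochainsMap h φ) τ))
  rw [restrict_cochainsMap, restrict_cochainsMap]

/-- The cosimplicial abelian group of singular cochains with values in `E`. -/
def cosimplicialCochains : CosimplicialObject AddCommGrpCat.{u} where
  obj n := AddCommGrpCat.of (E.Cochains n)
  map θ := AddCommGrpCat.ofHom (E.cochainsMap (TopSimplex.map θ))
  map_id n := by
    rw [TopSimplex.map_id, cochainsMap_id]
    rfl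
  map_comp θ η := by
    rw [TopSimplex.map_comp, cochainsMap_comp]
    rfl

/-- The singular cochain complex `C^*(X; E)`; the coboundary operator sends `φ` to the function
`τ ↦ ∑ i, (-1)^i φ (τ ∘ dⁱ)`, where the lift `φ (τ ∘ dⁱ)` of the `i`-th face is extended to a
lift of `τ`. -/
def cochainComplex : CochainComplex AddCommGrpCat.{u} ℕ :=
  (AlgebraicTopology.alternatingCofaceMapComplex AddCommGrpCat.{u}).obj E.cosimplicialCochains

/-- The cohomology group `H^n(X; E)`. -/
def cohomology (n : ℕ) : AddCommGrpCat.{u} := E.cochainComplex.homology n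

end GroupBundle

/-- Singular homology `H_n(X; ℤ/2)` with constant coefficients. -/
def modTwoHomology (n : ℕ) (X : Type u) [TopologicalSpace X] : AddCommGrpCat.{u} :=
  ((AlgebraicTopology.singularHomologyFunctor AddCommGrpCat.{u} n).obj
    (AddCommGrpCat.of (ULift.{u} (ZMod 2)))).obj (TopCat.of X)

end

/-!
Write `C` for the singular chain complex with coefficients in `ℓ`. It consists of free abelian
groups. As `ℓ/2` is canonically the product bundle with fibre `ℤ/2`, the complex `C/2` is the
singular chain complex with coefficients `ℤ/2` (`GroupBundle.reduction`), and as `ℓ ⊗ ℓ` is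
canonically the product bundle with fibre `ℤ`, twisted cochains are the homomorphisms `C → ℤ`
(`GroupBundle.pairing`).

A choice of a generator of each fibre is a homomorphism `ε : C₀ → ℤ`. Parallel transport preserves
generators up to sign, so `ε ∘ ∂ = 2W` for a twisted cocycle `W`, whose reduction modulo `2` is the
first Stiefel–Whitney class `w` of `ℓ`. If `w` vanished on `H₁(X; ℤ/2)`, then it would be a
coboundary, the generators could be corrected so as to be preserved by parallel transport, and `ℓ`
would be trivial (`GroupBundle.exists_odd_whitneyCocycle`). As `H₁(X; ℤ/2)` has two elements, the
class `w` is therefore injective on it. This has two consequences.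

* If `z` is a twisted cycle of degree `1`, then `2 W(z) = ε(∂z) = 0`, so `z` is a boundary modulo
  `2`. Thus multiplication by `2` is surjective on `H₁(X; ℓ)` (`exists_cycle_two_smul`). Since
  `H₁(X; ℓ)` is finitely generated, it is finite of odd order.
* If `2x = δy` for a twisted cochain `y` of degree `1`, then `y` is a cocycle modulo `2`, hence
  cohomologous modulo `2` to a multiple of `w`. As `w` is the reduction of the integral cocycle `W`,
  subtracting from `y` an integral cocycle makes it divisible by `2`, so that `x` is a coboundary
  (`exists_eq_comp_of_two_mul_eq`).

For the finite generation of `H₁(X; ℓ)` (`GroupBundle.finite_homology_one`), cover `X` by finitely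
many contractible open sets. On each of them the class of a lifted path, modulo boundaries, is the
difference of the values at its end points of a potential, which is given by the paths of the
contraction. On an overlap the difference of two potentials is constant along paths, so on a compact
part of the overlap it takes its values in a finitely generated group. Hence, up to a finitely
generated group, there is a potential for all paths in `X`, and cycles lie in that group.
-/

noncomputable section

/-! ### Homology of complexes of abelian groups -/

/-- The homology of a complex of abelian groups is the group of cycles modulo boundaries. -/
theorem exists_cycles_to_homology {ι : Type*} {c : ComplexShape ι}
    (K : HomologicalComplex AddCommGrpCat.{u} c) {i j k : ι} (hi : c.prev j = i)
    (hk : c.next j = k) {f : K.X i →+ K.X j} {g : K.X j →+ K.X k} (hf : (K.d i j).hom = f)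
    (hg : (K.d j k).hom = g) :
    ∃ π : g.ker →+ K.homology j, Function.Surjective π ∧ ∀ z, π z = 0 ↔ ∃ y, f y = z := by
  subst hf hg
  have key : ∀ S : ShortComplex AddCommGrpCat.{u}, ∃ π : S.g.hom.ker →+ S.homology,
      Function.Surjective π ∧ ∀ z, π z = 0 ↔ ∃ y, S.f.hom y = z := by
    intro S
    let e : S.homology ≃+ (S.g.hom.ker ⧸ S.abToCycles.range) :=
      S.abHomologyIso.addCommGroupIsoToAddEquiv
    refine ⟨e.symm.toAddMonoidHom.comp (QuotientAddGroup.mk' S.abToCycles.range),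
      e.symm.surjective.comp (QuotientAddGroup.mk'_surjective _), fun z => ?_⟩
    rw [AddMonoidHom.comp_apply, AddEquiv.coe_toAddMonoidHom, AddEquiv.map_eq_zero_iff,
      QuotientAddGroup.mk'_apply, QuotientAddGroup.eq_zero_iff]
    exact ⟨fun ⟨y, hy⟩ => ⟨y, congrArg Subtype.val hy⟩, fun ⟨y, hy⟩ => ⟨y, Subtype.ext hy⟩⟩
  obtain ⟨π, hπ, hπ0⟩ := key (K.sc' i j k)
  let e : (K.sc' i j k).homology ≃+ K.homology j :=
    (K.homologyIsoSc' i j k hi hk).symm.addCommGroupIsoToAddEquiv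
  exact ⟨e.toAddMonoidHom.comp π, e.surjective.comp hπ,
    fun z => (AddEquiv.map_eq_zero_iff e).trans (hπ0 z)⟩

/-! ### Algebra of abelian groups -/

/-- A homomorphism to `ℤ/2` which vanishes on `f⁻¹(2B)` extends along `f : A → B`: this is the
extension of linear forms over the field `ℤ/2`, applied to `A/2 → B/2`. -/
theorem exists_eq_comp_of_two_smul {A B : Type*} [AddCommGroup A] [AddCommGroup B] (f : A →+ B)
    (Y : A →+ ZMod 2) (h : ∀ a b, f a = 2 • b → Y a = 0) :
    ∃ c : B →+ ZMod 2, ∀ a, Y a = c (f a) := by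
  let p := QuotientAddGroup.mk' (nsmulAddMonoidHom 2 : A →+ A).range
  let q := QuotientAddGroup.mk' (nsmulAddMonoidHom 2 : B →+ B).range
  let : Module (ZMod 2) (A ⧸ (nsmulAddMonoidHom 2 : A →+ A).range) :=
    AddCommGroup.zmodModule fun x => by
      obtain ⟨a, rfl⟩ := QuotientAddGroup.mk_surjective x
      exact (QuotientAddGroup.eq_zero_iff (2 • a)).2 ⟨a, rfl⟩
  let : Module (ZMod 2) (B ⧸ (nsmulAddMonoidHom 2 : B →+ B).range) :=
    AddCommGroup.zmodModule fun x => by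
      obtain ⟨b, rfl⟩ := QuotientAddGroup.mk_surjective x
      exact (QuotientAddGroup.eq_zero_iff (2 • b)).2 ⟨b, rfl⟩
  let f' := (QuotientAddGroup.map (nsmulAddMonoidHom 2 : A →+ A).range
    (nsmulAddMonoidHom 2 : B →+ B).range f (by
      rintro _ ⟨a, rfl⟩
      exact ⟨f a, (map_nsmul f 2 a).symm⟩)).toZModLinearMap 2
  let Y' := (QuotientAddGroup.lift (nsmulAddMonoidHom 2 : A →+ A).range Y (by
      rintro _ ⟨a, rfl⟩
      exact h _ (f a) (map_nsmul f 2 a))).toZModLinearMap 2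
  have hY : Y' ∈ LinearMap.range f'.dualMap := by
    rw [LinearMap.range_dualMap_eq_dualAnnihilator_ker, Submodule.mem_dualAnnihilator]
    intro x hx
    obtain ⟨a, rfl⟩ := QuotientAddGroup.mk_surjective x
    obtain ⟨b, hb⟩ := (QuotientAddGroup.eq_zero_iff (f a)).1 hx
    exact h a b hb.symm
  obtain ⟨c, hc⟩ := hY
  exact ⟨c.toAddMonoidHom.comp q, fun a => (LinearMap.congr_fun hc (p a)).symm⟩

/-- A finitely generated abelian group on which multiplication by `2` is surjective is finite of
odd order. By Nakayama's lemma it is annihilated by an odd integer. -/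
theorem finite_and_odd_card_of_two_smul_surjective {A : Type*} [AddCommGroup A]
    [Module.Finite ℤ A] (h : ∀ a : A, ∃ b, a = 2 • b) : Finite A ∧ Odd (Nat.card A) := by
  obtain ⟨r, hr, hr0⟩ := Submodule.exists_sub_one_mem_and_smul_eq_zero_of_fg_of_le_smul
    (Ideal.span {(2 : ℤ)}) (⊤ : Submodule ℤ A) Module.Finite.fg_top (by
      intro a _
      obtain ⟨b, rfl⟩ := h a
      rw [← natCast_zsmul]
      exact Submodule.smul_mem_smul (Ideal.mem_span_singleton_self _) trivial)
  obtain ⟨m, hm⟩ := Ideal.mem_span_singleton'.1 hr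
  have hfin : Finite A := Module.finite_of_fg_torsion A fun a =>
    ⟨⟨r, mem_nonZeroDivisors_of_ne_zero (by omega)⟩, hr0 a trivial⟩
  refine ⟨hfin, Nat.not_even_iff_odd.1 fun hev => ?_⟩
  obtain ⟨a, ha⟩ := exists_prime_addOrderOf_dvd_card' 2 hev.two_dvd
  have h2 : (2 : ℤ) • a = 0 := by
    have := addOrderOf_nsmul_eq_zero a
    rw [ha] at this
    exact_mod_cast this
  have h1 : a = 0 := by
    have h3 := hr0 a trivial
    rw [show r = m * 2 + 1 by omega, add_smul, mul_smul, h2, smul_zero, zero_add, one_smul] at h3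
    exact h3
  rw [h1, addOrderOf_zero] at ha
  omega

/-- An automorphism of `ℤ` is multiplication by a sign. -/
theorem Int.addEquiv_apply_eq_or (e : ℤ ≃+ ℤ) :
    (∀ n, e n = n) ∨ ∀ n, e n = -n := by
  have h : ∀ n, e n = n * e 1 := fun n => by
    simpa using map_zsmul e n (1 : ℤ)
  have hu : IsUnit (e 1) := by
    refine IsUnit.of_mul_eq_one_right (e.symm 1) ?_
    rw [← h, e.apply_symm_apply]
  rcases Int.isUnit_iff.1 hu with h1 | h1
  · exact Or.inl fun n => by rw [h, h1, mul_one]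
  · exact Or.inr fun n => by rw [h, h1, mul_neg_one]

/-- The product `ℤ × ℤ → ℤ` makes sense for any infinite cyclic group, as it does not depend on
the choice of a generator. -/
theorem AddEquiv.mul_eq_mul {A B : Type*} [AddCommGroup A] [AddCommGroup B] (e : A ≃+ B)
    (α : A ≃+ ℤ) (β : B ≃+ ℤ) (a b : A) : β (e a) * β (e b) = α a * α b := by
  have h := Int.addEquiv_apply_eq_or ((α.symm.trans e).trans β)
  have h1 : ∀ a, ((α.symm.trans e).trans β) (α a) = β (e a) := fun a => by simp
  rw [← h1, ← h1]
  rcases h with h | h <;> simp [h]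

theorem AddEquiv.even_iff {A B : Type*} [AddCommGroup A] [AddCommGroup B] (e : A ≃+ B)
    (α : A ≃+ ℤ) (β : B ≃+ ℤ) (a : A) : Even (β (e a)) ↔ Even (α a) := by
  have h := e.mul_eq_mul α β a a
  have h1 := congrArg Even h
  rwa [Int.even_mul, Int.even_mul, or_self, or_self, eq_iff_iff] at h1

/-- Let `C₂ → C₁ → C₀` be a complex of abelian groups with `C₀` torsion-free, such that
`H₁(C/2)` has at most two elements. Suppose that `ε : C₀ → ℤ` satisfies `ε ∘ d = 2W`, where `W`
is odd on some cycle modulo `2`. Then each cycle modulo `2` on which `W` is even is a boundary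
modulo `2`. -/
theorem exists_eq_add_of_even {C₀ C₁ C₂ : Type*} [AddCommGroup C₀] [AddCommGroup C₁]
    [AddCommGroup C₂] {d₂ : C₂ →+ C₁} {d₁ : C₁ →+ C₀} (hd : ∀ y, d₁ (d₂ y) = 0)
    (hU : ∀ z₁ z₂ y₁ y₂, d₁ z₁ = 2 • y₁ → d₁ z₂ = 2 • y₂ →
      (∃ t x, z₁ = d₂ t + 2 • x) ∨ (∃ t x, z₂ = d₂ t + 2 • x) ∨ ∃ t x, z₁ + z₂ = d₂ t + 2 • x)
    {ε : C₀ →+ ℤ} {W : C₁ →+ ℤ} (hW : ∀ z, ε (d₁ z) = 2 * W z)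
    {z₀ : C₁} {y₀ : C₀} (hz₀ : d₁ z₀ = 2 • y₀) (hWz₀ : Odd (W z₀))
    {z : C₁} {y : C₀} (hz : d₁ z = 2 • y) (hWz : Even (W z)) : ∃ t x, z = d₂ t + 2 • x := by
  have hB : ∀ t x, Even (W (d₂ t + 2 • x)) := fun t x => by
    have h := hW (d₂ t)
    rw [hd, map_zero] at h
    rw [map_add, show W (d₂ t) = 0 by omega, zero_add, map_nsmul]
    exact ⟨W x, two_nsmul _⟩
  rcases hU z z₀ y y₀ hz hz₀ with h | ⟨t, x, h⟩ | ⟨t, x, h⟩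
  · exact h
  · exact absurd (h ▸ hB t x) (Int.not_even_iff_odd.2 hWz₀)
  · have h1 := hB t x
    rw [← h, map_add] at h1
    exact absurd h1 (Int.not_even_iff_odd.2 (hWz.add_odd hWz₀))

/-- In the situation of `exists_eq_add_of_even`, multiplication by `2` is surjective on
`H₁(C)`. -/
theorem exists_cycle_two_smul {C₀ C₁ C₂ : Type*} [AddCommGroup C₀] [AddCommGroup C₁]
    [AddCommGroup C₂] [IsAddTorsionFree C₀] {d₂ : C₂ →+ C₁} {d₁ : C₁ →+ C₀}
    (hd : ∀ y, d₁ (d₂ y) = 0)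
    (hU : ∀ z₁ z₂ y₁ y₂, d₁ z₁ = 2 • y₁ → d₁ z₂ = 2 • y₂ →
      (∃ t x, z₁ = d₂ t + 2 • x) ∨ (∃ t x, z₂ = d₂ t + 2 • x) ∨ ∃ t x, z₁ + z₂ = d₂ t + 2 • x)
    {ε : C₀ →+ ℤ} {W : C₁ →+ ℤ} (hW : ∀ z, ε (d₁ z) = 2 * W z)
    {z₀ : C₁} {y₀ : C₀} (hz₀ : d₁ z₀ = 2 • y₀) (hWz₀ : Odd (W z₀))
    {z : C₁} (hz : d₁ z = 0) : ∃ t x, d₁ x = 0 ∧ z = d₂ t + 2 • x := by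
  have hWz : W z = 0 := by
    have h := hW z
    rw [hz, map_zero] at h
    omega
  obtain ⟨t, x, h⟩ := exists_eq_add_of_even hd hU hW hz₀ hWz₀ (y := 0) (by rw [hz, smul_zero])
    (hWz ▸ Even.zero)
  refine ⟨t, x, ?_, h⟩
  have h1 : (2 : ℕ) • d₁ x = 0 := by rw [← map_nsmul, ← hz, h, map_add, hd, zero_add]
  exact (smul_eq_zero.1 h1).resolve_left two_ne_zero

/-- In the situation of `exists_eq_add_of_even`, `H²(Hom(C, ℤ))` has no `2`-torsion. -/
theorem exists_eq_comp_of_two_mul_eq {C₀ C₁ C₂ : Type*} [AddCommGroup C₀] [AddCommGroup C₁]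
    [AddCommGroup C₂] {d₂ : C₂ →+ C₁} {d₁ : C₁ →+ C₀} (hd : ∀ y, d₁ (d₂ y) = 0)
    (hU : ∀ z₁ z₂ y₁ y₂, d₁ z₁ = 2 • y₁ → d₁ z₂ = 2 • y₂ →
      (∃ t x, z₁ = d₂ t + 2 • x) ∨ (∃ t x, z₂ = d₂ t + 2 • x) ∨ ∃ t x, z₁ + z₂ = d₂ t + 2 • x)
    {ε : C₀ →+ ℤ} {W : C₁ →+ ℤ} (hW : ∀ z, ε (d₁ z) = 2 * W z)
    {z₀ : C₁} {y₀ : C₀} (hz₀ : d₁ z₀ = 2 • y₀) (hWz₀ : Odd (W z₀))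
    (hlift : ∀ c : C₀ →+ ZMod 2, ∃ c' : C₀ →+ ℤ, ∀ a, c a = c' a)
    {x : C₂ →+ ℤ} {y : C₁ →+ ℤ} (hxy : ∀ t, y (d₂ t) = 2 * x t) :
    ∃ z : C₁ →+ ℤ, ∀ t, x t = z (d₂ t) := by
  have hWd : ∀ t, W (d₂ t) = 0 := fun t => by
    have h := hW (d₂ t)
    rw [hd, map_zero] at h
    omega
  -- `y - kW` is even on `z₀`, hence on all cycles modulo `2`
  obtain ⟨k, hk⟩ : ∃ k : ℤ, Even (y z₀ - k * W z₀) := by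
    refine ⟨y z₀, ?_⟩
    obtain ⟨m, hm⟩ := hWz₀
    exact ⟨-(y z₀ * m), by rw [hm]; ring⟩
  let r := y - k • W
  have hrz₀ : Even (r z₀) := by simpa [r] using hk
  have hB : ∀ t x', Even (r (d₂ t + 2 • x')) := fun t x' => by
    rw [map_add, map_nsmul]
    refine Even.add ?_ ⟨r x', two_nsmul _⟩
    simp [r, hWd, hxy]
  have hr : ∀ z y', d₁ z = 2 • y' → Even (r z) := by
    intro z y' hz
    rcases Int.even_or_odd (W z) with h | h
    · obtain ⟨t, x', rfl⟩ := exists_eq_add_of_even hd hU hW hz₀ hWz₀ hz h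
      exact hB t x'
    · obtain ⟨t, x', h1⟩ := exists_eq_add_of_even hd hU hW hz₀ hWz₀ (z := z + z₀)
        (y := y' + y₀) (by rw [map_add, hz, hz₀, smul_add]) (by rw [map_add]; exact h.add_odd hWz₀)
      have h2 := hB t x'
      rw [← h1, map_add] at h2
      exact (Int.even_add.1 h2).2 hrz₀
  obtain ⟨c, hc⟩ := exists_eq_comp_of_two_smul d₁ ((Int.castAddHom (ZMod 2)).comp r)
    fun z y' h => (ZMod.intCast_eq_zero_iff_even).2 (hr z y' h)
  obtain ⟨c', hc'⟩ := hlift c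
  let s := r - c'.comp d₁
  have hs : ∀ z, Even (s z) := fun z => by
    rw [← ZMod.intCast_eq_zero_iff_even]
    have := hc z
    simp only [AddMonoidHom.comp_apply, Int.coe_castAddHom] at this
    simp [s, this, hc']
  refine ⟨AddMonoidHom.mk' (fun z => s z / 2) fun a b => ?_, fun t => ?_⟩
  · rw [map_add, Int.add_ediv_of_dvd_left (hs a).two_dvd]
  · simp only [AddMonoidHom.mk'_apply, s, r, AddMonoidHom.sub_apply, AddMonoidHom.comp_apply, hd,
      map_zero, sub_zero, AddMonoidHom.zsmul_apply, hWd, smul_zero, hxy]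
    omega

namespace GroupBundle

/-! ### Boundary operators -/

section Boundary

variable {G : Type*} [AddCommGroup G] [TopologicalSpace G] [DiscreteTopology G]
  {X : Type u} [TopologicalSpace X] (E : GroupBundle G X)

/-- The boundary operator on singular chains with values in `E`. -/
def boundary (n : ℕ) : E.Chains (.mk (n + 1)) →+ E.Chains (.mk n) :=
  ∑ i : Fin (n + 2), (-1 : ℤ) ^ (i : ℕ) • E.chainsMap (TopSimplex.map (SimplexCategory.δ i))

theorem chainComplex_d (n : ℕ) : (E.chainComplex.d (n + 1) n).hom = E.boundary n := by
  have h : E.chainComplex.d (n + 1) n =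
      AlgebraicTopology.AlternatingFaceMapComplex.objD E.simplicialChains n :=
    AlgebraicTopology.alternatingFaceMapComplex_obj_d _ _
  rw [h, AlgebraicTopology.AlternatingFaceMapComplex.objD, boundary]
  exact map_sum AddCommGrpCat.homAddEquiv _ _

theorem boundary_boundary (n : ℕ) (c : E.Chains (.mk (n + 2))) :
    E.boundary n (E.boundary (n + 1) c) = 0 := by
  have h := congrArg (fun f => f.hom c) (E.chainComplex.d_comp_d (n + 2) (n + 1) n)
  rw [← E.chainComplex_d, ← E.chainComplex_d]
  exact h

/-- The coboundary operator on singular cochains with values in `E`. -/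
def coboundary (n : ℕ) : E.Cochains (.mk n) →+ E.Cochains (.mk (n + 1)) :=
  ∑ i : Fin (n + 2), (-1 : ℤ) ^ (i : ℕ) • E.cochainsMap (TopSimplex.map (SimplexCategory.δ i))

theorem cochainComplex_d (n : ℕ) : (E.cochainComplex.d n (n + 1)).hom = E.coboundary n := by
  have h : E.cochainComplex.d n (n + 1) =
      AlgebraicTopology.AlternatingCofaceMapComplex.objD E.cosimplicialCochains n :=
    CochainComplex.of_d (fun n => E.cosimplicialCochains.obj (.mk n)) _ n
  rw [h, AlgebraicTopology.AlternatingCofaceMapComplex.objD, coboundary]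
  exact map_sum AddCommGrpCat.homAddEquiv _ _

/-- Homology classes are classes of cycles modulo boundaries. -/
theorem exists_cycles_to_homology (n : ℕ) :
    ∃ π : (E.boundary n).ker →+ E.homology (n + 1), Function.Surjective π ∧
      ∀ z, π z = 0 ↔ ∃ t, E.boundary (n + 1) t = z :=
  _root_.exists_cycles_to_homology E.chainComplex (by simp) (by simp) (E.chainComplex_d (n + 1))
    (E.chainComplex_d n)

/-- Cohomology classes are classes of cocycles modulo coboundaries. -/
theorem exists_cocycles_to_cohomology (n : ℕ) :
    ∃ π : (E.coboundary (n + 1)).ker →+ E.cohomology (n + 1), Function.Surjective π ∧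
      ∀ z, π z = 0 ↔ ∃ y, E.coboundary n y = z :=
  _root_.exists_cycles_to_homology E.cochainComplex (by simp) (by simp) (E.cochainComplex_d n)
    (E.cochainComplex_d (n + 1))

open Classical in
theorem liftAddHom_simplexChain {n : SimplexCategory} {M : Type*} [AddCommGroup M]
    (f : ∀ σ : C(TopSimplex n, X), E.lifts σ →+ M) (σ : C(TopSimplex n, X)) (s : E.lifts σ) :
    DFinsupp.liftAddHom f (E.simplexChain σ s) = f σ s := by
  simp [simplexChain]

/-! ### Fibres and lifts -/

theorem exists_fiber_addEquiv (x : X) : Nonempty (E.fiber x ≃+ G) := by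
  obtain ⟨e, hx, he⟩ := E.locally_trivial x
  exact ⟨{ toFun := fun v => (e ⟨x, v⟩).2
           invFun := e.symm x
           left_inv := fun v => e.symm_apply_apply_mk hx v
           right_inv := fun g => congrArg Prod.snd (e.apply_mk_symm hx g)
           map_add' := he x hx }⟩

/-- Lifts of a singular simplex correspond to their values at a point of the simplex. -/
def evalEquiv {n : SimplexCategory} (σ : C(TopSimplex n, X)) (a : TopSimplex n) :
    E.lifts σ ≃+ E.fiber (σ a) :=
  AddEquiv.ofBijective (AddMonoidHom.mk' (fun s : E.lifts σ => s.1 a) fun _ _ => rfl) <| by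
    constructor
    · exact fun s t h => E.lifts_ext σ s t a h
    · exact fun v => E.exists_lift σ a v (TopSimplex.contract a)
        (fun x => Subtype.ext (by simp [TopSimplex.contract]))
        (fun x => Subtype.ext (by simp [TopSimplex.contract]))
        (fun t => Subtype.ext (by simp [TopSimplex.contract, ← add_smul]))

end Boundary

/-! ### The pairing of twisted cochains and twisted chains -/

section Pairing

variable {X : Type u} [TopologicalSpace X] (ℓ : GroupBundle ℤ X)

/-- A choice of a generator of the infinite cyclic group of lifts of a singular simplex. -/
def liftsEquiv {n : SimplexCategory} (σ : C(TopSimplex n, X)) : ℓ.lifts σ ≃+ ℤ :=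
  (ℓ.evalEquiv σ (Classical.arbitrary _)).trans (ℓ.exists_fiber_addEquiv _).some

open Classical in
/-- The homomorphism from twisted chains to `ℤ` given by a twisted cochain, that is, the pairing
induced by the canonical isomorphism `ℓ ⊗ ℓ ≅ ℤ`. It does not depend on the generators used to
write it down. -/
def pairing {n : SimplexCategory} : ℓ.Cochains n →+ ℓ.Chains n →+ ℤ :=
  AddMonoidHom.mk' (fun φ => DFinsupp.liftAddHom fun σ =>
    (AddMonoidHom.mulLeft (ℓ.liftsEquiv σ (φ σ))).comp (ℓ.liftsEquiv σ).toAddMonoidHom) <| by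
  intro φ ψ
  refine ℓ.chains_hom_ext fun σ s => ?_
  simp [simplexChain, add_mul]

open Classical in
theorem pairing_simplexChain {n : SimplexCategory} (φ : ℓ.Cochains n) (σ : C(TopSimplex n, X))
    (s : ℓ.lifts σ) :
    ℓ.pairing φ (ℓ.simplexChain σ s) = ℓ.liftsEquiv σ (φ σ) * ℓ.liftsEquiv σ s :=
  ℓ.liftAddHom_simplexChain _ σ s

theorem pairing_cochainsMap {m n : SimplexCategory} (g : C(TopSimplex m, TopSimplex n))
    (φ : ℓ.Cochains m) :
    ℓ.pairing (ℓ.cochainsMap g φ) = (ℓ.pairing φ).comp (ℓ.chainsMap g) := by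
  refine ℓ.chains_hom_ext fun σ s => ?_
  rw [AddMonoidHom.comp_apply, chainsMap_simplexChain, pairing_simplexChain, pairing_simplexChain,
    ← ℓ.restrict_cochainsMap g φ σ]
  exact ((ℓ.restrictEquiv σ g).mul_eq_mul _ _ _ _).symm

theorem pairing_coboundary (n : ℕ) (φ : ℓ.Cochains (.mk n)) (c : ℓ.Chains (.mk (n + 1))) :
    ℓ.pairing (ℓ.coboundary n φ) c = ℓ.pairing φ (ℓ.boundary n c) := by
  simp [coboundary, boundary, AddMonoidHom.finsetSum_apply, pairing_cochainsMap]

theorem pairing_injective {n : SimplexCategory} :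
    Function.Injective (ℓ.pairing (n := n)) := by
  intro φ ψ h
  funext σ
  have h1 := DFunLike.congr_fun h (ℓ.simplexChain σ ((ℓ.liftsEquiv σ).symm 1))
  simpa [pairing_simplexChain] using h1

theorem pairing_surjective {n : SimplexCategory} :
    Function.Surjective (ℓ.pairing (n := n)) := by
  intro f
  refine ⟨fun σ => (ℓ.liftsEquiv σ).symm (f (ℓ.simplexChain σ ((ℓ.liftsEquiv σ).symm 1))),
    ℓ.chains_hom_ext fun σ s => ?_⟩
  obtain ⟨k, rfl⟩ := (ℓ.liftsEquiv σ).symm.surjective s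
  have h : (ℓ.liftsEquiv σ).symm k = k • (ℓ.liftsEquiv σ).symm 1 := by
    rw [← map_zsmul, smul_eq_mul, mul_one]
  rw [pairing_simplexChain, h]
  simp [mul_comm]

/-- The twisted chain groups are free, so homomorphisms to `ℤ/2` lift to `ℤ`. -/
theorem exists_lift_zmod_two {n : SimplexCategory} (c : ℓ.Chains n →+ ZMod 2) :
    ∃ c' : ℓ.Chains n →+ ℤ, ∀ a, c a = c' a := by
  choose f hf using fun σ : C(TopSimplex n, X) =>
    ZMod.intCast_surjective (c (ℓ.simplexChain σ ((ℓ.liftsEquiv σ).symm 1)))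
  refine ⟨ℓ.pairing fun σ => (ℓ.liftsEquiv σ).symm (f σ), DFunLike.congr_fun
    (g := (Int.castAddHom (ZMod 2)).comp (ℓ.pairing fun σ => (ℓ.liftsEquiv σ).symm (f σ)))
    (ℓ.chains_hom_ext fun σ s => ?_)⟩
  obtain ⟨k, rfl⟩ := (ℓ.liftsEquiv σ).symm.surjective s
  have h : (ℓ.liftsEquiv σ).symm k = k • (ℓ.liftsEquiv σ).symm 1 := by
    rw [← map_zsmul, smul_eq_mul, mul_one]
  rw [AddMonoidHom.comp_apply, pairing_simplexChain, h]
  simp [hf, mul_comm]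

instance {n : SimplexCategory} : IsAddTorsionFree (ℓ.Chains n) where
  nsmul_right_injective k hk c c' h := by
    refine DFinsupp.ext fun σ => (ℓ.liftsEquiv σ).injective ?_
    have h1 := congrArg (fun c : ℓ.Chains n => ℓ.liftsEquiv σ (c σ)) h
    simpa [hk] using h1

end Pairing

/-! ### Reduction modulo 2 -/

section ModTwo

open Limits

variable {X : Type u} [TopologicalSpace X] (ℓ : GroupBundle ℤ X)

/-- The residue modulo `2` of a lift of a singular simplex, for either choice of a generator. -/
def parity {n : SimplexCategory} (σ : C(TopSimplex n, X)) :
    ℓ.lifts σ →+ ULift.{u} (ZMod 2) :=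
  (AddEquiv.ulift.symm.toAddMonoidHom.comp (Int.castAddHom (ZMod 2))).comp
    (ℓ.liftsEquiv σ).toAddMonoidHom

theorem parity_eq_zero {n : SimplexCategory} (σ : C(TopSimplex n, X)) (s : ℓ.lifts σ) :
    ℓ.parity σ s = 0 ↔ Even (ℓ.liftsEquiv σ s) := by
  rw [← ZMod.intCast_eq_zero_iff_even]
  exact ULift.up_injective.eq_iff

theorem parity_surjective {n : SimplexCategory} (σ : C(TopSimplex n, X)) :
    Function.Surjective (ℓ.parity σ) :=
  (AddEquiv.ulift.symm.surjective.comp ZMod.intCast_surjective).comp (ℓ.liftsEquiv σ).surjective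

theorem parity_restrict {m n : SimplexCategory} (σ : C(TopSimplex n, X))
    (g : C(TopSimplex m, TopSimplex n)) (s : ℓ.lifts σ) :
    ℓ.parity (σ.comp g) (ℓ.restrict σ g s) = ℓ.parity σ s := by
  change AddEquiv.ulift.symm ((ℓ.liftsEquiv _ (ℓ.restrictEquiv σ g s) : ℤ) : ZMod 2) =
    AddEquiv.ulift.symm ((ℓ.liftsEquiv σ s : ℤ) : ZMod 2)
  rw [EmbeddingLike.apply_eq_iff_eq, ← sub_eq_zero, ← Int.cast_sub, ZMod.intCast_eq_zero_iff_even,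
    Int.even_sub]
  exact (ℓ.restrictEquiv σ g).even_iff _ _ s

variable (X) in
/-- The simplicial abelian group of singular chains with coefficients `ℤ/2` from which
`modTwoHomology` is defined. -/
abbrev modTwoSimplicial : SimplicialObject AddCommGrpCat.{u} :=
  ((SimplicialObject.whiskering _ _).obj
    (sigmaConst.obj (AddCommGrpCat.of (ULift.{u} (ZMod 2))))).obj
    (TopCat.toSSet.obj (TopCat.of X))

/-- The singular chain `r · σ` with coefficients `ℤ/2`. -/
def modTwoSingle (n : SimplexCategoryᵒᵖ) (σ : C(TopSimplex n.unop, X)) :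
    ULift.{u} (ZMod 2) →+ (modTwoSimplicial X).obj n :=
  (Sigma.ι (fun _ : (TopCat.toSSet.obj (TopCat.of X)).obj n =>
    AddCommGrpCat.of (ULift.{u} (ZMod 2))) ((TopCat.toSSetObjEquiv (TopCat.of X) n).symm σ)).hom

theorem map_modTwoSingle {m n : SimplexCategoryᵒᵖ} (θ : m ⟶ n) (σ : C(TopSimplex m.unop, X))
    (r : ULift.{u} (ZMod 2)) :
    ((modTwoSimplicial X).map θ).hom (modTwoSingle m σ r) =
      modTwoSingle n (σ.comp (TopSimplex.map θ.unop)) r := by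
  have h := Sigma.ι_comp_map' (f := fun _ => AddCommGrpCat.of (ULift.{u} (ZMod 2)))
    (g := fun _ => AddCommGrpCat.of (ULift.{u} (ZMod 2)))
    ((TopCat.toSSet.obj (TopCat.of X)).map θ) (fun _ => 𝟙 _)
    ((TopCat.toSSetObjEquiv (TopCat.of X) m).symm σ)
  exact congrArg (fun f => f.hom r) h

theorem modTwoSimplicial_hom_ext {n : SimplexCategoryᵒᵖ} {A : AddCommGrpCat.{u}}
    {f g : (modTwoSimplicial X).obj n ⟶ A}
    (h : ∀ σ r, f.hom (modTwoSingle n σ r) = g.hom (modTwoSingle n σ r)) : f = g := by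
  refine Sigma.hom_ext _ _ fun τ => ?_
  obtain ⟨σ, rfl⟩ := (TopCat.toSSetObjEquiv (TopCat.of X) n).symm.surjective τ
  ext1
  ext1 r
  exact h σ r

open Classical in
theorem exists_coefficient (n : SimplexCategoryᵒᵖ) (σ : C(TopSimplex n.unop, X)) :
    ∃ p : (modTwoSimplicial X).obj n →+ ULift.{u} (ZMod 2),
      ∀ τ r, p (modTwoSingle n τ r) = if τ = σ then r else 0 := by
  let q : ∀ τ : (TopCat.toSSet.obj (TopCat.of X)).obj n,
      AddCommGrpCat.of (ULift.{u} (ZMod 2)) ⟶ AddCommGrpCat.of (ULift.{u} (ZMod 2)) :=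
    fun τ => if TopCat.toSSetObjEquiv (TopCat.of X) n τ = σ then 𝟙 _ else 0
  refine ⟨(Sigma.desc q).hom, fun τ r => ?_⟩
  have h := Sigma.ι_desc q ((TopCat.toSSetObjEquiv (TopCat.of X) n).symm τ)
  have h1 := congrArg (fun f => f.hom r) h
  refine h1.trans ?_
  simp only [q, Equiv.apply_symm_apply]
  split_ifs <;> rfl

open Classical in
/-- Reduction modulo `2` in degree `n`. -/
def reductionHom (n : SimplexCategoryᵒᵖ) :
    ℓ.Chains n.unop →+ (modTwoSimplicial X).obj n :=
  DFinsupp.liftAddHom fun σ => (modTwoSingle n σ).comp (ℓ.parity σ)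

open Classical in
theorem reductionHom_simplexChain (n : SimplexCategoryᵒᵖ) (σ : C(TopSimplex n.unop, X))
    (s : ℓ.lifts σ) :
    ℓ.reductionHom n (ℓ.simplexChain σ s) = modTwoSingle n σ (ℓ.parity σ s) :=
  ℓ.liftAddHom_simplexChain _ σ s

/-- Reduction modulo `2` from twisted chains to chains with coefficients `ℤ/2`: a lift of a
singular simplex is sent to the simplex, multiplied by the residue of the lift. -/
def reduction : ℓ.simplicialChains ⟶ modTwoSimplicial X where
  app n := AddCommGrpCat.ofHom (ℓ.reductionHom n)
  naturality m n θ := by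
    ext1
    refine ℓ.chains_hom_ext fun σ s => ?_
    change ℓ.reductionHom n (ℓ.chainsMap (TopSimplex.map θ.unop) (ℓ.simplexChain σ s)) =
      ((modTwoSimplicial X).map θ).hom (ℓ.reductionHom m (ℓ.simplexChain σ s))
    rw [chainsMap_simplexChain, reductionHom_simplexChain, reductionHom_simplexChain,
      parity_restrict, map_modTwoSingle]

theorem reductionHom_surjective (n : SimplexCategoryᵒᵖ) :
    Function.Surjective (ℓ.reductionHom n) := by
  suffices Epi (AddCommGrpCat.ofHom (ℓ.reductionHom n)) from
    (AddCommGrpCat.epi_iff_surjective _).1 this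
  refine ⟨fun f g h => modTwoSimplicial_hom_ext fun σ r => ?_⟩
  obtain ⟨s, rfl⟩ := ℓ.parity_surjective σ r
  rw [← reductionHom_simplexChain]
  exact congrArg (fun f => f.hom (ℓ.simplexChain σ s)) h

open Classical in
/-- The kernel of the reduction modulo `2` consists of the multiples of `2`. -/
theorem exists_eq_two_smul_of_reductionHom_eq_zero (n : SimplexCategoryᵒᵖ) (c : ℓ.Chains n.unop)
    (hc : ℓ.reductionHom n c = 0) : ∃ c', c = 2 • c' := by
  have h : ∀ σ, Even (ℓ.liftsEquiv σ (c σ)) := by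
    intro σ
    obtain ⟨p, hp⟩ := exists_coefficient n σ
    have h0 : p.comp (ℓ.reductionHom n) = (ℓ.parity σ).comp
        (DFinsupp.evalAddMonoidHom σ : ℓ.Chains n.unop →+ ℓ.lifts σ) := by
      refine ℓ.chains_hom_ext fun τ s => ?_
      rw [AddMonoidHom.comp_apply, reductionHom_simplexChain, hp]
      change _ = ℓ.parity σ (DFinsupp.single (β := fun τ => ℓ.lifts τ) τ s σ)
      by_cases hτ : τ = σ
      · subst hτ
        rw [DFinsupp.single_eq_same, if_pos rfl]
      · rw [DFinsupp.single_eq_of_ne (Ne.symm hτ), if_neg hτ, map_zero]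
    rw [← parity_eq_zero]
    have h1 := DFunLike.congr_fun h0 c
    rw [AddMonoidHom.comp_apply, hc, map_zero] at h1
    exact h1.symm
  refine ⟨c.mapRange (fun σ s => (ℓ.liftsEquiv σ).symm (ℓ.liftsEquiv σ s / 2)) (by simp),
    DFinsupp.ext fun σ => (ℓ.liftsEquiv σ).injective ?_⟩
  obtain ⟨k, hk⟩ := h σ
  simp [hk]
  omega

/-- If `H₁(X; ℤ/2)` is isomorphic to `ℤ/2`, then of any two cycles modulo `2` in the twisted chain
complex and their sum, one is a boundary modulo `2`. -/
theorem boundary_mod_two_of_modTwoHomology_equiv (hX : Nonempty (modTwoHomology 1 X ≃+ ZMod 2))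
    (z₁ z₂ : ℓ.Chains (.mk 1)) (y₁ y₂ : ℓ.Chains (.mk 0)) (h₁ : ℓ.boundary 0 z₁ = 2 • y₁)
    (h₂ : ℓ.boundary 0 z₂ = 2 • y₂) :
    (∃ t x, z₁ = ℓ.boundary 1 t + 2 • x) ∨ (∃ t x, z₂ = ℓ.boundary 1 t + 2 • x) ∨
      ∃ t x, z₁ + z₂ = ℓ.boundary 1 t + 2 • x := by
  obtain ⟨e⟩ := hX
  let K := (AlgebraicTopology.alternatingFaceMapComplex AddCommGrpCat.{u}).obj (modTwoSimplicial X)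
  let ρ : ℓ.chainComplex ⟶ K :=
    (AlgebraicTopology.alternatingFaceMapComplex AddCommGrpCat.{u}).map ℓ.reduction
  have hρ : ∀ n, (ρ.f n).hom = ℓ.reductionHom (op (.mk n)) := fun n => rfl
  have hcomm : ∀ n (c : ℓ.Chains (.mk (n + 1))),
      (K.d (n + 1) n).hom (ℓ.reductionHom (op (.mk (n + 1))) c) =
        ℓ.reductionHom (op (.mk n)) (ℓ.boundary n c) := by
    intro n c
    have h := congrArg (fun f => f.hom c) (ρ.comm (n + 1) n)
    rw [← ℓ.chainComplex_d, ← hρ, ← hρ]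
    exact h
  obtain ⟨π, hπ, hπ0⟩ := _root_.exists_cycles_to_homology K (i := 2) (j := 1) (k := 0)
    (by simp) (by simp) rfl rfl
  have htwo : ∀ y : ℓ.Chains (.mk 0), ℓ.reductionHom (op (.mk 0)) (2 • y) = 0 := by
    intro y
    suffices (ℓ.reductionHom (op (.mk 0))).comp (nsmulAddMonoidHom 2) = 0 from
      DFunLike.congr_fun this y
    refine ℓ.chains_hom_ext fun σ s => ?_
    rw [AddMonoidHom.comp_apply, nsmulAddMonoidHom_apply, ← map_nsmul (ℓ.simplexChain σ),
      reductionHom_simplexChain, (ℓ.parity_eq_zero σ _).2 (by simp), map_zero]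
    rfl
  have hcyc : ∀ z y, ℓ.boundary 0 z = 2 • y →
      ℓ.reductionHom (op (.mk 1)) z ∈ (K.d 1 0).hom.ker := by
    intro z y h
    rw [AddMonoidHom.mem_ker, hcomm 0, h, htwo]
  have hbd : ∀ z (h : ℓ.reductionHom (op (.mk 1)) z ∈ (K.d 1 0).hom.ker), π ⟨_, h⟩ = 0 →
      ∃ t x, z = ℓ.boundary 1 t + 2 • x := by
    intro z h hz
    obtain ⟨w, hw⟩ := (hπ0 _).1 hz
    obtain ⟨t, rfl⟩ := ℓ.reductionHom_surjective (op (.mk 2)) w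
    obtain ⟨x, hx⟩ := ℓ.exists_eq_two_smul_of_reductionHom_eq_zero (op (.mk 1))
      (z - ℓ.boundary 1 t) (by rw [map_sub, ← hcomm 1, hw, sub_self])
    exact ⟨t, x, by rw [← hx, add_sub_cancel]⟩
  let e' : K.homology 1 ≃+ ZMod 2 := e
  have h2 : ∀ a b : ZMod 2, a = 0 ∨ b = 0 ∨ a + b = 0 := by decide
  have h3 : ∀ z (h : ℓ.reductionHom (op (.mk 1)) z ∈ (K.d 1 0).hom.ker), e' (π ⟨_, h⟩) = 0 →
      ∃ t x, z = ℓ.boundary 1 t + 2 • x :=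
    fun z h hz => hbd z h ((AddEquiv.map_eq_zero_iff e').1 hz)
  rcases h2 (e' (π ⟨_, hcyc z₁ y₁ h₁⟩)) (e' (π ⟨_, hcyc z₂ y₂ h₂⟩)) with h | h | h
  · exact Or.inl (h3 _ _ h)
  · exact Or.inr (Or.inl (h3 _ _ h))
  · refine Or.inr (Or.inr (h3 _ (hcyc (z₁ + z₂) (y₁ + y₂) (by rw [map_add, h₁, h₂, nsmul_add])) ?_))
    have h4 : (⟨_, hcyc (z₁ + z₂) (y₁ + y₂) (by rw [map_add, h₁, h₂, nsmul_add])⟩ :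
        (K.d 1 0).hom.ker) = ⟨_, hcyc z₁ y₁ h₁⟩ + ⟨_, hcyc z₂ y₂ h₂⟩ :=
      Subtype.ext (map_add (ℓ.reductionHom (op (.mk 1))) z₁ z₂)
    rw [h4, map_add, map_add]
    exact h

end ModTwo

end GroupBundle

/-! ### Affine simplices -/

section Affine

variable {V : Type*} [AddCommGroup V] [Module ℝ V] [TopologicalSpace V] [ContinuousAdd V]
  [ContinuousSMul ℝ V]

/-- The affine simplex with the vertices `v i`. -/
def affineSimplex {n : ℕ} (v : Fin (n + 1) → V) : C(TopSimplex (.mk n), V) :=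
  ⟨fun x => ∑ i : Fin (n + 1), x.1 i • v i,
    continuous_finsetSum _ fun i _ =>
      ((continuous_apply i).comp continuous_subtype_val).smul continuous_const⟩

theorem affineSimplex_vertex {n : ℕ} (v : Fin (n + 1) → V) (i : Fin (n + 1)) :
    affineSimplex v (stdSimplex.vertex i) = v i := by
  simp [affineSimplex, Pi.single_apply]

theorem affineSimplex_comp_map {m n : ℕ} (v : Fin (n + 1) → V)
    (θ : SimplexCategory.mk m ⟶ SimplexCategory.mk n) :
    (affineSimplex v).comp (TopSimplex.map θ) = affineSimplex fun i => v (θ i) := by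
  ext x
  have h : ∀ j : Fin (n + 1), (TopSimplex.map θ x).1 j = ∑ i with θ i = j, x.1 i := fun j =>
    FunOnFinite.linearMap_apply_apply ℝ ℝ θ x.1 j
  simp only [affineSimplex, ContinuousMap.comp_apply, ContinuousMap.coe_mk, h, Finset.sum_smul]
  rw [← Finset.sum_fiberwise Finset.univ θ fun i => x.1 i • v (θ i)]
  refine Finset.sum_congr rfl fun j _ => Finset.sum_congr rfl fun i hi => ?_
  rw [(Finset.mem_filter.1 hi).2]

end Affine

namespace GroupBundle

section TotalSpace

variable {G : Type*} [AddCommGroup G] [TopologicalSpace G] [DiscreteTopology G]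
  {X : Type u} [TopologicalSpace X] (E : GroupBundle G X)

/-! ### Singular simplices of the total space -/

/-- A lift of a map, as a map to the total space. -/
def liftMap {A : Type*} [TopologicalSpace A] (σ : C(A, X)) (s : E.lifts σ) : C(A, E.Total) :=
  ⟨fun a => ⟨σ a, s.1 a⟩, s.2⟩

theorem liftMap_ext {A : Type*} [TopologicalSpace A] [PreconnectedSpace A] {S S' : C(A, E.Total)}
    (h : ∀ a, (S a).proj = (S' a).proj) (a₀ : A) (h₀ : S a₀ = S' a₀) : S = S' :=
  DFunLike.coe_injective
    (E.isCoveringMap.eq_of_comp_eq S.continuous S'.continuous (funext h) a₀ h₀)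

/-- Lifts of maps from a real topological vector space exist and have arbitrary values at a given
point, as the vector space is contractible. -/
theorem exists_liftMap {V : Type*} [AddCommGroup V] [Module ℝ V] [TopologicalSpace V]
    [ContinuousAdd V] [ContinuousSMul ℝ V] (σ : C(V, X)) (a : V) (w : E.Total)
    (hw : w.proj = σ a) : ∃ S : C(V, E.Total), (∀ x, (S x).proj = σ x) ∧ S a = w := by
  obtain ⟨x, v⟩ := w
  obtain rfl : x = σ a := hw
  obtain ⟨s, hs⟩ := E.exists_lift σ a v
    ⟨fun p => (1 - p.1.1) • a + p.1.1 • p.2, by fun_prop⟩ (by simp) (by simp)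
    (fun t => by simp [← add_smul])
  exact ⟨E.liftMap σ s, fun _ => rfl, by rw [← hs]; rfl⟩

/-- The chain of a singular simplex of the total space, viewed as a lift of its projection. -/
def liftedSimplex {n : SimplexCategory} (τ : C(TopSimplex n, E.Total)) : E.Chains n :=
  E.simplexChain ⟨fun a => (τ a).proj, E.isCoveringMap.continuous.comp τ.continuous⟩
    ⟨fun a => (τ a).2, τ.continuous⟩

theorem chainsMap_liftedSimplex {m n : SimplexCategory} (g : C(TopSimplex m, TopSimplex n))
    (τ : C(TopSimplex n, E.Total)) :
    E.chainsMap g (E.liftedSimplex τ) = E.liftedSimplex (τ.comp g) :=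
  E.chainsMap_simplexChain g _ _

theorem simplexChain_eq_liftedSimplex {n : SimplexCategory} (σ : C(TopSimplex n, X))
    (s : E.lifts σ) : E.simplexChain σ s = E.liftedSimplex (E.liftMap σ s) := rfl

/-- The `0`-chains given by elements of a fibre. -/
def pointChain (x : X) : E.fiber x →+ E.Chains (.mk 0) :=
  (E.simplexChain (.const _ x)).comp
    (E.evalEquiv (.const (TopSimplex (.mk 0)) x) (stdSimplex.vertex 0)).symm.toAddMonoidHom

theorem liftedSimplex_eq_pointChain (τ : C(TopSimplex (.mk 0), E.Total)) (a : TopSimplex (.mk 0)) :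
    E.liftedSimplex τ = E.pointChain (τ a).proj (τ a).2 := by
  obtain rfl : a = stdSimplex.vertex 0 := Subsingleton.elim _ _
  let s := (E.evalEquiv (.const (TopSimplex (.mk 0)) (τ (stdSimplex.vertex 0)).proj)
    (stdSimplex.vertex 0)).symm (τ (stdSimplex.vertex 0)).2
  have hs : s.1 (stdSimplex.vertex 0) = (τ (stdSimplex.vertex 0)).2 :=
    (E.evalEquiv (.const (TopSimplex (.mk 0)) (τ (stdSimplex.vertex 0)).proj)
      (stdSimplex.vertex 0)).apply_symm_apply _
  have h : τ = E.liftMap (.const _ (τ (stdSimplex.vertex 0)).proj) s := by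
    ext1 a
    obtain rfl : a = stdSimplex.vertex 0 := Subsingleton.elim _ _
    change _ = (⟨_, s.1 (stdSimplex.vertex 0)⟩ : E.Total)
    rw [hs]
    rfl
  change _ = E.liftedSimplex (E.liftMap _ s)
  rw [← h]

theorem boundary_zero_apply (c : E.Chains (.mk 1)) :
    E.boundary 0 c = E.chainsMap (TopSimplex.map (SimplexCategory.δ 0)) c -
      E.chainsMap (TopSimplex.map (SimplexCategory.δ 1)) c := by
  simp [boundary, Fin.sum_univ_succ, sub_eq_add_neg]

theorem boundary_one_apply (c : E.Chains (.mk 2)) :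
    E.boundary 1 c = E.chainsMap (TopSimplex.map (SimplexCategory.δ 0)) c -
      E.chainsMap (TopSimplex.map (SimplexCategory.δ 1)) c +
      E.chainsMap (TopSimplex.map (SimplexCategory.δ 2)) c := by
  simp [boundary, Fin.sum_univ_succ, sub_eq_add_neg, add_assoc]

/-- The boundary of a lifted path is the difference of its end points. -/
theorem boundary_zero_liftedSimplex (τ : C(TopSimplex (.mk 1), E.Total)) :
    E.boundary 0 (E.liftedSimplex τ) =
      E.pointChain (τ (stdSimplex.vertex 1)).proj (τ (stdSimplex.vertex 1)).2 -
        E.pointChain (τ (stdSimplex.vertex 0)).proj (τ (stdSimplex.vertex 0)).2 := by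
  have h0 : TopSimplex.map (SimplexCategory.δ (0 : Fin 2)) (stdSimplex.vertex 0) =
      stdSimplex.vertex 1 := stdSimplex.map_vertex _ _
  have h1 : TopSimplex.map (SimplexCategory.δ (1 : Fin 2)) (stdSimplex.vertex 0) =
      stdSimplex.vertex 0 := stdSimplex.map_vertex _ _
  rw [boundary_zero_apply, chainsMap_liftedSimplex, chainsMap_liftedSimplex,
    E.liftedSimplex_eq_pointChain _ (stdSimplex.vertex 0),
    E.liftedSimplex_eq_pointChain _ (stdSimplex.vertex 0),
    ContinuousMap.comp_apply, ContinuousMap.comp_apply, h0, h1]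

/-! ### Segments in the total space -/

/-- The group of `1`-chains modulo boundaries. -/
def ChainClasses : Type u := E.Chains (.mk 1) ⧸ (E.boundary 1).range

instance : AddCommGroup E.ChainClasses :=
  inferInstanceAs (AddCommGroup (E.Chains (.mk 1) ⧸ (E.boundary 1).range))

/-- The class of a `1`-chain modulo boundaries. -/
def toChainClasses : E.Chains (.mk 1) →+ E.ChainClasses :=
  QuotientAddGroup.mk' (E.boundary 1).range

theorem toChainClasses_eq_zero (c : E.Chains (.mk 1)) :
    E.toChainClasses c = 0 ↔ ∃ t, E.boundary 1 t = c :=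
  QuotientAddGroup.eq_zero_iff c

section Segment

variable {V : Type*} [AddCommGroup V] [Module ℝ V] [TopologicalSpace V] [ContinuousAdd V]
  [ContinuousSMul ℝ V]

/-- For a map `S` from a real vector space to the total space, the class of the image of the
segment from `a` to `b`. -/
def segment (S : C(V, E.Total)) (a b : V) : E.ChainClasses :=
  E.toChainClasses (E.liftedSimplex (S.comp (affineSimplex ![a, b])))

theorem segment_add_segment (S : C(V, E.Total)) (a b c : V) :
    E.segment S a b + E.segment S b c = E.segment S a c := by
  have h : E.toChainClasses (E.boundary 1 (E.liftedSimplex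
      (S.comp (affineSimplex ![a, b, c])))) = 0 := (E.toChainClasses_eq_zero _).2 ⟨_, rfl⟩
  rw [boundary_one_apply] at h
  simp only [map_add, map_sub, chainsMap_liftedSimplex, ContinuousMap.comp_assoc,
    affineSimplex_comp_map] at h
  have h0 : (fun i => ![a, b, c] (SimplexCategory.δ (0 : Fin 3) i)) = ![b, c] := by
    funext i; fin_cases i <;> rfl
  have h1 : (fun i => ![a, b, c] (SimplexCategory.δ (1 : Fin 3) i)) = ![a, c] := by
    funext i; fin_cases i <;> rfl
  have h2 : (fun i => ![a, b, c] (SimplexCategory.δ (2 : Fin 3) i)) = ![a, b] := by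
    funext i; fin_cases i <;> rfl
  rw [h0, h1, h2] at h
  change E.segment S b c - E.segment S a c + E.segment S a b = 0 at h
  rw [← sub_eq_zero, ← h]
  abel

theorem segment_self (S : C(V, E.Total)) (a : V) : E.segment S a a = 0 :=
  left_eq_add.1 (E.segment_add_segment S a a a).symm

variable {V' : Type*} [AddCommGroup V'] [Module ℝ V'] [TopologicalSpace V'] [ContinuousAdd V']
  [ContinuousSMul ℝ V']

/-- A map which is affine on the segment from `a` to `b` maps it to a segment. -/
theorem segment_comp (S : C(V', E.Total)) (L : C(V, V')) (a b : V)
    (hL : ∀ s t : ℝ, 0 ≤ s → 0 ≤ t → s + t = 1 → L (s • a + t • b) = s • L a + t • L b) :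
    E.segment (S.comp L) a b = E.segment S (L a) (L b) := by
  have h : L.comp (affineSimplex ![a, b]) = affineSimplex ![L a, L b] := by
    ext x
    have hx : x.1 0 + x.1 1 = 1 := by
      rw [← x.2.2]
      exact (Fin.sum_univ_two x.1).symm
    simpa [affineSimplex, Fin.sum_univ_two] using hL _ _ (x.2.1 0) (x.2.1 1) hx
  rw [segment, segment, ContinuousMap.comp_assoc, h]

theorem segment_of_proj_eq (S : C(V, E.Total)) (x : X) (hS : ∀ a, (S a).proj = x) (a b : V) :
    E.segment S a b = 0 := by
  have : PreconnectedSpace V := PathConnectedSpace.connectedSpace.toPreconnectedSpace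
  have h : S = S.comp (.const V a) :=
    E.liftMap_ext (fun y => (hS y).trans (hS a).symm) a rfl
  rw [h, segment_comp]
  · exact E.segment_self S a
  · intro s t _ _ hst
    simp [← add_smul, hst]

end Segment

end TotalSpace

section Potential

variable {G : Type*} [AddCommGroup G] [TopologicalSpace G] [DiscreteTopology G]
  {X : Type u} [TopologicalSpace X] (E : GroupBundle G X)

/-! ### Potentials on contractible sets -/

/-- Homomorphisms `r x` from the fibres over a set `O` to the `1`-chains modulo boundaries form a
potential on `O` if the class of each lifted path in `O` is the difference of the values of `r` at
its end points. -/
def IsPotential (O : Set X) (r : ∀ x, E.fiber x →+ E.ChainClasses) : Prop :=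
  ∀ p : C(ℝ, E.Total), (∀ t, (p t).proj ∈ O) →
    ∀ s t, E.segment p s t = r _ (p s).2 - r _ (p t).2

/-- Sending `v` to the class of the lift of the path `γ` which starts at `v` is a homomorphism. -/
theorem exists_hom_segment (γ : C(ℝ, X)) (x : X) (h : γ 0 = x) :
    ∃ f : E.fiber x →+ E.ChainClasses, ∀ (v : E.fiber x) (S : C(ℝ, E.Total)),
      (∀ u, (S u).proj = γ u) → S 0 = ⟨x, v⟩ → f v = E.segment S 0 1 := by
  subst h
  have hL : ∀ v : E.fiber (γ 0), ∃ s : E.lifts γ, s.1 0 = v := fun v =>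
    E.exists_lift γ 0 v ⟨fun p => p.1.1 • p.2, by fun_prop⟩ (by simp) (by simp) (by simp)
  choose L hL using hL
  let L' : E.fiber (γ 0) →+ E.lifts γ := AddMonoidHom.mk' L fun v w =>
    E.lifts_ext γ _ _ 0 (by
      rw [hL]
      change _ = (L v).1 0 + (L w).1 0
      rw [hL, hL])
  refine ⟨E.toChainClasses.comp ((E.simplexChain (γ.comp (affineSimplex ![0, 1]))).comp
    ((E.restrict γ (affineSimplex ![0, 1])).comp L')), fun v S hS hS0 => ?_⟩
  have h : S = E.liftMap γ (L v) := E.liftMap_ext hS 0 (by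
    rw [hS0]
    change _ = (⟨γ 0, (L v).1 0⟩ : E.Total)
    rw [hL])
  rw [h]
  rfl

/-- A set which contracts to a point within `X` carries a potential: the value at `v` is the class
of the lift, starting at `v`, of the path traced by the contraction. -/
theorem exists_isPotential_of_contraction (O : Set X) (H : C(unitInterval × O, X)) (x₀ : X)
    (h0 : ∀ y, H (0, y) = y) (h1 : ∀ y, H (1, y) = x₀) : ∃ r, E.IsPotential O r := by
  classical
  let γ : O → C(ℝ, X) := fun y => ⟨fun u => H (Set.projIcc 0 1 zero_le_one u, y), by fun_prop⟩
  have hγ : ∀ y, γ y 0 = y := fun y => by simp [γ, h0]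
  choose f hf using fun y : O => E.exists_hom_segment (γ y) y (hγ y)
  refine ⟨fun x => if hx : x ∈ O then f ⟨x, hx⟩ else 0, fun p hp s t => ?_⟩
  beta_reduce
  rw [dif_pos (hp s), dif_pos (hp t)]
  let p' : C(ℝ, O) := ⟨fun t => ⟨(p t).proj, hp t⟩,
    (E.isCoveringMap.continuous.comp p.continuous).subtype_mk _⟩
  let F : C(ℝ × ℝ, X) := ⟨fun q => H (Set.projIcc 0 1 zero_le_one q.2, p' q.1), by fun_prop⟩
  have hF0 : ∀ a, F (a, 0) = (p a).proj := fun a => by simp [F, p', h0]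
  have hF1 : ∀ a, F (a, 1) = x₀ := fun a => by simp [F, h1]
  obtain ⟨S, hS, hSs⟩ := E.exists_liftMap F (s, 0) (p s) (hF0 s).symm
  let bottom : C(ℝ, ℝ × ℝ) := ⟨fun a => (a, 0), by fun_prop⟩
  let top : C(ℝ, ℝ × ℝ) := ⟨fun a => (a, 1), by fun_prop⟩
  let side : ℝ → C(ℝ, ℝ × ℝ) := fun a => ⟨fun u => (a, u), by fun_prop⟩
  have hbot : S.comp bottom = p := E.liftMap_ext (fun a => (hS _).trans (hF0 a)) s hSs
  have hSp : ∀ a, S (a, 0) = p a := fun a => DFunLike.congr_fun hbot a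
  have hside : ∀ a, E.segment S (a, 0) (a, 1) = f ⟨_, hp a⟩ (p a).2 := fun a => by
    rw [hf ⟨_, hp a⟩ (p a).2 (S.comp (side a)) (fun u => hS _) (hSp a)]
    refine (E.segment_comp S (side a) 0 1 fun x y _ _ hxy => ?_).symm
    ext <;> simp [side, ← add_mul, hxy]
  have hbottom : E.segment S (s, 0) (t, 0) = E.segment p s t := by
    rw [← hbot]
    refine (E.segment_comp S bottom s t fun x y _ _ hxy => ?_).symm
    ext <;> simp [bottom]
  have htop : E.segment S (s, 1) (t, 1) = 0 := by
    rw [← E.segment_of_proj_eq (S.comp top) x₀ (fun a => (hS _).trans (hF1 a)) s t]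
    refine (E.segment_comp S top s t fun x y _ _ hxy => ?_).symm
    ext <;> simp [top, hxy]
  have key := (E.segment_add_segment S (s, 0) (t, 0) (t, 1)).trans
    (E.segment_add_segment S (s, 0) (s, 1) (t, 1)).symm
  rw [htop, hside, hside, hbottom, add_zero] at key
  exact eq_sub_of_add_eq key

/-- Each point of a manifold has a neighbourhood which carries a potential. -/
theorem exists_isPotential {n : ℕ} [ChartedSpace (ClosedHalfSpace n) X] (x : X) :
    ∃ O : Set X, IsOpen O ∧ x ∈ O ∧ ∃ r, E.IsPotential O r := by
  let e := chartAt (ClosedHalfSpace n) x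
  have hx : x ∈ e.source := mem_chart_source _ x
  obtain ⟨ε, hε, hball⟩ := Metric.isOpen_iff.1 e.open_target (e x) (e.map_source hx)
  let O := e.source ∩ e ⁻¹' Metric.ball (e x) ε
  have hO : IsOpen O := e.isOpen_inter_preimage Metric.isOpen_ball
  -- straight lines to `e x` in the chart
  let line : unitInterval × O → ClosedHalfSpace n := fun q =>
    ⟨(1 - q.1.1) • (e q.2).1 + q.1.1 • (e x).1, fun i hi => by
      have h1 := (e q.2).2 i hi
      have h2 := (e x).2 i hi
      have h3 : 0 ≤ 1 - q.1.1 := sub_nonneg.2 q.1.2.2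
      have h4 := q.1.2.1
      simp only [PiLp.add_apply, PiLp.smul_apply, smul_eq_mul]
      positivity⟩
  have hline : Continuous line := by
    have h : Continuous fun y : O => (e y.1).1 := continuous_subtype_val.comp
      (e.continuousOn.comp_continuous continuous_subtype_val fun y => y.2.1)
    refine Continuous.subtype_mk ?_ _
    have h2 : Continuous fun q : unitInterval × O => (e q.2).1 := h.comp continuous_snd
    fun_prop
  have hmem : ∀ q, line q ∈ e.target := fun q => by
    refine hball ?_
    have h1 : (e q.2).1 ∈ Metric.ball (e x).1 ε := q.2.2.2
    exact (convex_ball (e x).1 ε) h1 (Metric.mem_ball_self hε) (sub_nonneg.2 q.1.2.2) q.1.2.1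
      (by ring)
  refine ⟨O, hO, ⟨hx, Metric.mem_ball_self hε⟩, E.exists_isPotential_of_contraction O
    ⟨fun q => e.symm (line q), e.continuousOn_symm.comp_continuous hline hmem⟩ x
    (fun y => ?_) (fun y => ?_)⟩
  · have : line (0, y) = e y := Subtype.ext (by simp [line])
    simp [this, e.left_inv y.2.1]
  · have : line (1, y) = e x := Subtype.ext (by simp [line])
    simp [this, e.left_inv hx]

/-! ### Finite generation of the first homology -/

/-- The difference of two potentials is constant along paths, so over a compact set its values lie
in a finitely generated subgroup. -/
theorem exists_fg_sub_mem [Module.Finite ℤ G] [LocallyPathConnectedSpace X] {O O' : Set X}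
    (hO : IsOpen O) (hO' : IsOpen O') {r r' : ∀ x, E.fiber x →+ E.ChainClasses}
    (hr : E.IsPotential O r) (hr' : E.IsPotential O' r') {K : Set X} (hK : IsCompact K)
    (hKO : K ⊆ O ∩ O') : ∃ A : Submodule ℤ E.ChainClasses, A.FG ∧
      ∀ x ∈ K, ∀ v, r x v - r' x v ∈ A := by
  refine hK.induction_on (p := fun K => ∃ A : Submodule ℤ E.ChainClasses, A.FG ∧
      ∀ x ∈ K, ∀ v, r x v - r' x v ∈ A) ⟨⊥, Submodule.fg_bot, by simp⟩ ?_ ?_ ?_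
  · rintro s t hst ⟨A, hA, h⟩
    exact ⟨A, hA, fun x hx => h x (hst hx)⟩
  · rintro s t ⟨A, hA, h⟩ ⟨B, hB, h'⟩
    refine ⟨A ⊔ B, hA.sup hB, ?_⟩
    rintro x (hx | hx) v
    · exact Submodule.mem_sup_left (h x hx v)
    · exact Submodule.mem_sup_right (h' x hx v)
  · intro x hx
    obtain ⟨α⟩ := E.exists_fiber_addEquiv x
    have : Module.Finite ℤ (E.fiber x) := Module.Finite.equiv α.symm.toIntLinearEquiv
    refine ⟨pathComponentIn (O ∩ O') x, mem_nhdsWithin_of_mem_nhds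
      (pathComponentIn_mem_nhds ((hO.inter hO').mem_nhds (hKO hx))),
      LinearMap.range (r x - r' x).toIntLinearMap, Module.Finite.iff_fg.1 inferInstance, ?_⟩
    rintro y ⟨γ, hγ⟩ v
    obtain ⟨S, hS, hS1⟩ := E.exists_liftMap γ.extend 1 ⟨y, v⟩ (by simp)
    have hSO : ∀ t, (S t).proj ∈ O ∩ O' := fun t => by
      rw [hS]
      exact hγ _
    have h := (hr S (fun t => (hSO t).1) 0 1).symm.trans (hr' S (fun t => (hSO t).2) 0 1)
    have h0 : (S 0).proj = x := by rw [hS, γ.extend_zero]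
    rw [sub_eq_sub_iff_sub_eq_sub, hS1] at h
    rw [← h]
    generalize S 0 = w at h0
    obtain ⟨x', w⟩ := w
    obtain rfl : x' = x := h0
    exact ⟨w, rfl⟩

/-- If, along a path, `h` differs from local potentials by elements of `A`, then `h` is a potential
along the path modulo `A`. -/
theorem segment_sub_add_mem {q : C(ℝ, E.Total)} {A : Submodule ℤ E.ChainClasses}
    (h : ∀ x, E.fiber x →+ E.ChainClasses)
    (hq : ∀ t, ∃ (U : Set X) (r : ∀ x, E.fiber x →+ E.ChainClasses), IsOpen U ∧ (q t).proj ∈ U ∧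
      E.IsPotential U r ∧ ∀ x ∈ U, ∀ v, r x v - h x v ∈ A) (s t : ℝ) :
    E.segment q s t + h _ (q t).2 - h _ (q s).2 ∈ A := by
  let f : ℝ → E.ChainClasses ⧸ A := fun t => A.mkQ (E.segment q s t + h _ (q t).2)
  have hf : IsLocallyConstant f := by
    refine (IsLocallyConstant.iff_eventually_eq f).2 fun t => ?_
    obtain ⟨U, r, hU, htU, hr, hrh⟩ := hq t
    have hpre : (fun t => (q t).proj) ⁻¹' U ∈ 𝓝 t :=
      ((hU.preimage (E.isCoveringMap.continuous.comp q.continuous)).mem_nhds htU)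
    obtain ⟨ε, hε, hball⟩ := Metric.nhds_basis_closedBall.mem_iff.1 hpre
    rw [Real.closedBall_eq_Icc] at hball
    have hab : t - ε ≤ t + ε := by linarith
    -- the path is made constant outside of the interval, so as to stay in `U`
    let L : C(ℝ, ℝ) := ⟨fun u => Set.projIcc (t - ε) (t + ε) hab u, by fun_prop⟩
    have hL : ∀ u ∈ Set.Icc (t - ε) (t + ε), L u = u := fun u hu =>
      congrArg Subtype.val (Set.projIcc_of_mem hab hu)
    have htI : t ∈ Set.Icc (t - ε) (t + ε) := ⟨by linarith, by linarith⟩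
    filter_upwards [Icc_mem_nhds (show t - ε < t by linarith) (show t < t + ε by linarith)]
      with t' ht'
    have h1 : E.segment (q.comp L) t t' = E.segment q t t' := by
      rw [E.segment_comp q L t t' fun x y hx hy hxy => ?_, hL t htI, hL t' ht']
      rw [hL t htI, hL t' ht']
      exact hL _ ((convex_Icc (t - ε) (t + ε)) htI ht' hx hy hxy)
    have h2 := hr (q.comp L) (fun u => hball (Set.projIcc (t - ε) (t + ε) hab u).2) t t'
    rw [h1, ContinuousMap.comp_apply, ContinuousMap.comp_apply, hL t htI, hL t' ht'] at h2
    rw [← sub_eq_zero, ← map_sub, Submodule.mkQ_apply, Submodule.Quotient.mk_eq_zero,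
      ← E.segment_add_segment q s t t', h2]
    have ht'U : (q t').proj ∈ U := hball ht'
    have h3 := A.sub_mem (hrh _ htU (q t).2) (hrh _ ht'U (q t').2)
    convert h3 using 1
    abel
  have h1 := hf.apply_eq_of_isPreconnected isPreconnected_univ (Set.mem_univ t) (Set.mem_univ s)
  rw [← sub_eq_zero, ← map_sub, Submodule.mkQ_apply, Submodule.Quotient.mk_eq_zero,
    E.segment_self, zero_add] at h1
  exact h1

/-- Each lifted singular `1`-simplex is a segment of a path parametrized by `ℝ`. -/
theorem exists_comp_affineSimplex_eq (τ : C(TopSimplex (.mk 1), E.Total)) :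
    ∃ q : C(ℝ, E.Total), q.comp (affineSimplex ![0, 1]) = τ := by
  let g : C(ℝ, TopSimplex (.mk 1)) :=
    ⟨fun t => stdSimplexHomeomorphUnitInterval.symm (Set.projIcc 0 1 zero_le_one t), by fun_prop⟩
  refine ⟨τ.comp g, ?_⟩
  ext1 x
  change τ (stdSimplexHomeomorphUnitInterval.symm _) = τ x
  congr 1
  rw [Homeomorph.symm_apply_eq]
  have h : (affineSimplex ![(0 : ℝ), 1]) x = (stdSimplexHomeomorphUnitInterval x).1 := by
    simp [affineSimplex, Fin.sum_univ_two, stdSimplexHomeomorphUnitInterval]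
    rfl
  rw [h, Set.projIcc_val]

open Classical in
/-- The cycles of degree `1` modulo boundaries lie in a finitely generated group. -/
theorem exists_fg_cycle_mem [Module.Finite ℤ G] [LocallyPathConnectedSpace X] [T2Space X]
    [CompactSpace X] (hpot : ∀ x, ∃ O : Set X, IsOpen O ∧ x ∈ O ∧ ∃ r, E.IsPotential O r) :
    ∃ A : Submodule ℤ E.ChainClasses, A.FG ∧
      ∀ z, E.boundary 0 z = 0 → E.toChainClasses z ∈ A := by
  choose O hO hxO r hr using hpot
  choose K hK hxK hKO using fun x => exists_compact_subset (hO x) (hxO x)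
  obtain ⟨T, -, hT⟩ := isCompact_univ.elim_nhds_subcover (fun x => interior (K x)) fun x _ =>
    isOpen_interior.mem_nhds (hxK x)
  choose A hA hdiff using fun i j => E.exists_fg_sub_mem (hO i) (hO j) (hr i) (hr j)
    ((hK i).inter (hK j)) (Set.inter_subset_inter (hKO i) (hKO j))
  let B := ⨆ i ∈ T, ⨆ j ∈ T, A i j
  have hB : ∀ i ∈ T, ∀ j ∈ T, A i j ≤ B := fun i hi j hj =>
    (le_iSup₂ (f := fun j (_ : j ∈ T) => A i j) j hj).trans
      (le_iSup₂ (f := fun i (_ : i ∈ T) => ⨆ j ∈ T, A i j) i hi)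
  -- a potential on `X` up to `B`, with jumps between the pieces of the cover
  have hcov : ∀ x, ∃ i ∈ T, x ∈ interior (K i) := fun x => by
    simpa using hT (Set.mem_univ x)
  choose i hiT hi using hcov
  let h : ∀ x, E.fiber x →+ E.ChainClasses := fun x => r (i x) x
  let h' : E.Chains (.mk 0) →+ E.ChainClasses := DFinsupp.liftAddHom fun σ =>
    (h (σ (stdSimplex.vertex 0))).comp (E.evalEquiv σ (stdSimplex.vertex 0)).toAddMonoidHom
  have hh' : ∀ x v, h' (E.pointChain x v) = h x v := fun x v => by
    change h' (E.simplexChain (.const _ x) ((E.evalEquiv (.const _ x) _).symm v)) = _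
    refine (E.liftAddHom_simplexChain _ _ _).trans ?_
    exact congrArg (h x) (AddEquiv.apply_symm_apply _ v)
  have key : (B.mkQ.toAddMonoidHom.comp (E.toChainClasses + h'.comp (E.boundary 0))) = 0 := by
    refine E.chains_hom_ext fun σ s => ?_
    rw [simplexChain_eq_liftedSimplex]
    generalize E.liftMap σ s = τ
    obtain ⟨q, rfl⟩ := E.exists_comp_affineSimplex_eq τ
    refine (Submodule.Quotient.mk_eq_zero B).2 ?_
    rw [AddMonoidHom.add_apply, AddMonoidHom.comp_apply, boundary_zero_liftedSimplex, map_sub,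
      hh', hh', ContinuousMap.comp_apply, ContinuousMap.comp_apply, affineSimplex_vertex,
      affineSimplex_vertex, ← add_sub_assoc]
    refine E.segment_sub_add_mem h (fun t => ?_) 0 1
    refine ⟨interior (K (i (q t).proj)), r (i (q t).proj), isOpen_interior, hi _,
      fun p hp => hr _ p fun t => hKO _ (interior_subset (hp t)), fun x hx v => ?_⟩
    exact hB _ (hiT _) _ (hiT x) (hdiff _ _ x ⟨interior_subset hx, interior_subset (hi x)⟩ v)
  refine ⟨B, Submodule.fg_biSup T _ fun i _ => Submodule.fg_biSup T _ fun j _ => hA i j,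
    fun z hz => ?_⟩
  have h1 := (Submodule.Quotient.mk_eq_zero B).1 (DFunLike.congr_fun key z)
  rwa [AddMonoidHom.add_apply, AddMonoidHom.comp_apply, hz, map_zero, add_zero] at h1

/-- The first homology of a compact space, locally path-connected and with local potentials, with
coefficients in a bundle of finitely generated groups, is finitely generated. -/
theorem finite_homology_one [Module.Finite ℤ G] [LocallyPathConnectedSpace X] [T2Space X]
    [CompactSpace X] (hpot : ∀ x, ∃ O : Set X, IsOpen O ∧ x ∈ O ∧ ∃ r, E.IsPotential O r) :
    Module.Finite ℤ (E.homology 1) := by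
  obtain ⟨π, hπ, hπ0⟩ := E.exists_cycles_to_homology 0
  obtain ⟨A, hA, hcyc⟩ := E.exists_fg_cycle_mem hpot
  let f : (E.boundary 0).ker →ₗ[ℤ] A := (AddMonoidHom.mk' (fun z =>
    (⟨E.toChainClasses z.1, hcyc z.1 z.2⟩ : A))
      fun a b => Subtype.ext (map_add E.toChainClasses a.1 b.1)).toIntLinearMap
  have : Module.Finite ℤ A := Module.Finite.iff_fg.2 hA
  have hf : LinearMap.ker f ≤ LinearMap.ker π.toIntLinearMap := fun z hz => by
    exact (hπ0 z).2 ((E.toChainClasses_eq_zero z.1).1 (congrArg Subtype.val hz))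
  have : Module.Finite ℤ (_ ⧸ LinearMap.ker f) := Module.Finite.equiv f.quotKerEquivRange.symm
  exact Module.Finite.of_surjective ((LinearMap.ker f).liftQ π.toIntLinearMap hf) fun y => by
    obtain ⟨z, rfl⟩ := hπ y
    exact ⟨Submodule.Quotient.mk z, rfl⟩

end Potential

/-! ### Bundles without monodromy -/

section Trivial

variable {G : Type*} [AddCommGroup G] [TopologicalSpace G] [DiscreteTopology G]
  {X : Type u} [TopologicalSpace X] (E : GroupBundle G X)

/-- In a local trivialization, isomorphisms of the fibres with `G` which are compatible with lifted
paths are locally constant. -/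
theorem exists_nhds_apply_eq [LocallyPathConnectedSpace X] (γ : ∀ x, E.fiber x ≃+ G)
    (hγ : ∀ S : C(ℝ, E.Total), γ _ (S 0).2 = γ _ (S 1).2) (x : X)
    (e : Bundle.Trivialization G E.proj) (hx : x ∈ e.baseSet) :
    ∃ N ∈ 𝓝 x, ∀ y ∈ N, y ∈ e.baseSet ∧ ∀ v, γ y v = γ x (e.symm x (e ⟨y, v⟩).2) := by
  refine ⟨pathComponentIn e.baseSet x, pathComponentIn_mem_nhds (e.open_baseSet.mem_nhds hx), ?_⟩
  rintro y ⟨p, hp⟩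
  have hpe : ∀ t, p.extend t ∈ e.baseSet := fun t => hp _
  have hy : y ∈ e.baseSet := by simpa using hpe 1
  refine ⟨hy, fun v => ?_⟩
  have hS : ∀ t, (⟨p.extend t, e.symm (p.extend t) (e ⟨y, v⟩).2⟩ : E.Total) =
      e.toOpenPartialHomeomorph.symm (p.extend t, (e ⟨y, v⟩).2) := fun t =>
    e.mk_symm (hpe t) (e ⟨y, v⟩).2
  let S : C(ℝ, E.Total) := ⟨fun t => ⟨p.extend t, e.symm (p.extend t) (e ⟨y, v⟩).2⟩, by
    simp_rw [hS]
    refine e.toOpenPartialHomeomorph.continuousOn_symm.comp_continuous (by fun_prop) fun t => ?_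
    rw [e.target_eq]
    exact ⟨hpe t, trivial⟩⟩
  have h0 : ∀ a b, a = b →
      (⟨a, e.symm a (e ⟨y, v⟩).2⟩ : E.Total) = ⟨b, e.symm b (e ⟨y, v⟩).2⟩ := by
    rintro a _ rfl
    rfl
  have h := hγ S
  rw [show S 0 = _ from h0 _ _ p.extend_zero, show S 1 = _ from h0 _ _ p.extend_one] at h
  rw [h, e.symm_apply_apply_mk hy]

/-- A bundle is trivial if its fibres can be identified with `G` compatibly with lifted paths. -/
theorem isTrivial_of_forall_path [LocallyPathConnectedSpace X] (γ : ∀ x, E.fiber x ≃+ G)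
    (hγ : ∀ S : C(ℝ, E.Total), γ _ (S 0).2 = γ _ (S 1).2) : E.IsTrivial := by
  have hsnd : Continuous fun τ : E.Total => γ τ.proj τ.2 := by
    refine continuous_iff_continuousAt.2 fun τ => ?_
    obtain ⟨e, hx, -⟩ := E.locally_trivial τ.proj
    obtain ⟨N, hN, h⟩ := E.exists_nhds_apply_eq γ hγ τ.proj e hx
    refine (continuousAt_const (y := γ τ.proj τ.2)).congr ?_
    have h1 : ∀ᶠ τ' in 𝓝 τ, (e τ').2 = (e τ).2 :=
      (continuous_snd.continuousAt.comp (e.continuousAt (e.mem_source.2 hx))).eventually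
        ((isOpen_discrete {(e τ).2}).mem_nhds rfl)
    filter_upwards [h1, E.isCoveringMap.continuous.continuousAt.eventually hN] with τ' hτ' hτN
    rw [(h _ hτN).2 τ'.2, hτ', ← (h _ (mem_of_mem_nhds hN)).2 τ.2]
  have hinv : Continuous fun p : X × G => (⟨p.1, (γ p.1).symm p.2⟩ : E.Total) := by
    refine continuous_iff_continuousAt.2 fun q => ?_
    obtain ⟨e, hx, -⟩ := E.locally_trivial q.1
    obtain ⟨N, hN, h⟩ := E.exists_nhds_apply_eq γ hγ q.1 e hx
    refine (E.continuousAt_iff (⟨Prod.fst, continuous_fst⟩ : C(X × G, X)) _ q e hx).2 ?_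
    refine (continuousAt_const (y := (e ⟨q.1, (γ q.1).symm q.2⟩).2)).congr ?_
    filter_upwards [continuous_fst.continuousAt.eventually hN,
      continuous_snd.continuousAt.eventually ((isOpen_discrete {q.2}).mem_nhds rfl)] with p hp hpq
    have h1 := (h _ hp).2 ((γ p.1).symm p.2)
    rw [AddEquiv.apply_symm_apply, hpq, ← AddEquiv.symm_apply_eq] at h1
    rw [h1, e.apply_mk_symm hx]
    change _ = (e ⟨p.1, (γ p.1).symm p.2⟩).2
    rw [hpq]
  let H : E.Total ≃ₜ X × G :=
    { toFun := fun τ => (τ.proj, γ τ.proj τ.2)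
      invFun := fun p => ⟨p.1, (γ p.1).symm p.2⟩
      left_inv := fun τ => by simp
      right_inv := fun p => by simp
      continuous_toFun := E.isCoveringMap.continuous.prodMk hsnd
      continuous_invFun := hinv }
  exact ⟨{ toOpenPartialHomeomorph := H.toOpenPartialHomeomorph
           baseSet := Set.univ
           open_baseSet := isOpen_univ
           source_eq := rfl
           target_eq := by simp
           proj_toFun := fun _ _ => rfl }, rfl, fun y => map_add (γ y)⟩

end Trivial

/-! ### The first Stiefel–Whitney class -/

section Orientation

variable {X : Type u} [TopologicalSpace X] (ℓ : GroupBundle ℤ X)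

/-- A choice of a generator of each fibre, as a homomorphism `C₀(X; ℓ) → ℤ`. -/
def generatorHom : ℓ.Chains (.mk 0) →+ ℤ :=
  ℓ.pairing fun σ => (ℓ.liftsEquiv σ).symm 1

theorem generatorHom_simplexChain (σ : C(TopSimplex (.mk 0), X)) (s : ℓ.lifts σ) :
    ℓ.generatorHom (ℓ.simplexChain σ s) = ℓ.liftsEquiv σ s := by
  rw [generatorHom, pairing_simplexChain, AddEquiv.apply_symm_apply, one_mul]

theorem even_generatorHom_boundary (c : ℓ.Chains (.mk 1)) :
    Even (ℓ.generatorHom (ℓ.boundary 0 c)) := by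
  rw [← ZMod.intCast_eq_zero_iff_even]
  have h : ((Int.castAddHom (ZMod 2)).comp ℓ.generatorHom).comp (ℓ.boundary 0) = 0 := by
    refine ℓ.chains_hom_ext fun σ s => ?_
    rw [AddMonoidHom.comp_apply, AddMonoidHom.comp_apply, boundary_zero_apply,
      chainsMap_simplexChain, chainsMap_simplexChain, map_sub, generatorHom_simplexChain,
      generatorHom_simplexChain]
    refine (ZMod.intCast_eq_zero_iff_even).2 (Int.even_sub.2 ?_)
    exact ((ℓ.restrictEquiv σ _).even_iff (ℓ.liftsEquiv σ) _ s).trans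
      ((ℓ.restrictEquiv σ _).even_iff (ℓ.liftsEquiv σ) _ s).symm
  exact DFunLike.congr_fun h c

/-- The twisted cocycle whose double is the coboundary of a choice of generators of the fibres: it
counts the singular simplices along which the chosen generators are not preserved, and its reduction
modulo `2` represents the first Stiefel–Whitney class of `ℓ`. -/
def whitneyCocycle : ℓ.Chains (.mk 1) →+ ℤ :=
  AddMonoidHom.mk' (fun c => ℓ.generatorHom (ℓ.boundary 0 c) / 2) fun a b => by
    rw [map_add, map_add, Int.add_ediv_of_dvd_left (ℓ.even_generatorHom_boundary a).two_dvd]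

theorem generatorHom_boundary (c : ℓ.Chains (.mk 1)) :
    ℓ.generatorHom (ℓ.boundary 0 c) = 2 * ℓ.whitneyCocycle c :=
  (Int.mul_ediv_cancel' (ℓ.even_generatorHom_boundary c).two_dvd).symm

/-- If the first Stiefel–Whitney class of `ℓ` vanishes on the cycles modulo `2`, then the generators
of the fibres can be chosen so as to be preserved by parallel transport, and `ℓ` is trivial. -/
theorem exists_odd_whitneyCocycle [LocallyPathConnectedSpace X] (hℓ : ¬ ℓ.IsTrivial) :
    ∃ z y, ℓ.boundary 0 z = 2 • y ∧ Odd (ℓ.whitneyCocycle z) := by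
  classical
  by_contra! hev
  obtain ⟨c, hc⟩ := exists_eq_comp_of_two_smul (ℓ.boundary 0)
    ((Int.castAddHom (ZMod 2)).comp ℓ.whitneyCocycle) fun z y h =>
      ZMod.intCast_eq_zero_iff_even.2 (Int.not_odd_iff_even.1 (hev z y h))
  let α : ∀ x, ℓ.fiber x ≃+ ℤ := fun x =>
    (ℓ.evalEquiv (.const (TopSimplex (.mk 0)) x) (stdSimplex.vertex 0)).symm.trans
      (ℓ.liftsEquiv (.const _ x))
  have hα : ∀ x v, ℓ.generatorHom (ℓ.pointChain x v) = α x v := fun x v =>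
    ℓ.generatorHom_simplexChain _ _
  let k : X → ZMod 2 := fun x => c (ℓ.pointChain x ((α x).symm 1))
  have hk : ∀ x v, c (ℓ.pointChain x v) = α x v * k x := fun x v => by
    obtain ⟨m, rfl⟩ := (α x).symm.surjective v
    rw [AddEquiv.apply_symm_apply, show (α x).symm m = m • (α x).symm 1 by
      rw [← map_zsmul, smul_eq_mul, mul_one], map_zsmul, map_zsmul, zsmul_eq_mul]
  -- the generators are changed where `k` is not zero
  let γ : ∀ x, ℓ.fiber x ≃+ ℤ := fun x =>
    if k x = 0 then α x else (α x).trans (AddEquiv.neg ℤ)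
  have hγ : ∀ (σ : C(TopSimplex (.mk 1), X)) (s : ℓ.lifts σ),
      γ _ (s.1 (stdSimplex.vertex 0)) = γ _ (s.1 (stdSimplex.vertex 1)) := by
    intro σ s
    have hbd : ∀ s : ℓ.lifts σ, ∃ m : ℤ,
        2 * m = α _ (s.1 (stdSimplex.vertex 1)) - α _ (s.1 (stdSimplex.vertex 0)) ∧
        (m : ZMod 2) = α _ (s.1 (stdSimplex.vertex 1)) * k (σ (stdSimplex.vertex 1)) -
          α _ (s.1 (stdSimplex.vertex 0)) * k (σ (stdSimplex.vertex 0)) := by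
      intro s
      have h : ℓ.boundary 0 (ℓ.simplexChain σ s) =
          ℓ.pointChain _ (s.1 (stdSimplex.vertex 1)) - ℓ.pointChain _ (s.1 (stdSimplex.vertex 0)) :=
        ℓ.boundary_zero_liftedSimplex (ℓ.liftMap σ s)
      refine ⟨ℓ.whitneyCocycle (ℓ.simplexChain σ s), ?_, ?_⟩
      · rw [← generatorHom_boundary, h, map_sub, hα, hα]
      · refine (hc _).trans ?_
        rw [h, map_sub, hk, hk]
    let ev := ℓ.evalEquiv σ (stdSimplex.vertex 0)
    -- parallel transport in terms of the generators
    let τ : ℤ ≃+ ℤ := (((α _).symm.trans ev.symm).trans (ℓ.evalEquiv σ (stdSimplex.vertex 1))).trans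
      (α _)
    have hτ : ∀ s : ℓ.lifts σ, α _ (s.1 (stdSimplex.vertex 1)) =
        τ (α _ (s.1 (stdSimplex.vertex 0))) := fun s => by
      have h : ev.symm (s.1 (stdSimplex.vertex 0)) = s := ev.symm_apply_apply s
      simp only [τ, AddEquiv.trans_apply, AddEquiv.symm_apply_apply, h]
      rfl
    let s₁ : ℓ.lifts σ := ev.symm ((α _).symm 1)
    have hs₁ : α _ (s₁.1 (stdSimplex.vertex 0)) = 1 := by
      have h : s₁.1 (stdSimplex.vertex 0) = (α _).symm 1 := ev.apply_symm_apply _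
      rw [h, AddEquiv.apply_symm_apply]
    obtain ⟨m, hm, hm2⟩ := hbd s₁
    rw [hτ, hs₁] at hm hm2
    have h2 : ∀ a : ZMod 2, a = 0 ∨ a = 1 := by decide
    simp only [γ]
    generalize k (σ (stdSimplex.vertex 0)) = k₀ at hm2 ⊢
    generalize k (σ (stdSimplex.vertex 1)) = k₁ at hm2 ⊢
    rcases Int.addEquiv_apply_eq_or τ with h | h
    · obtain rfl : m = 0 := by rw [h] at hm; omega
      have hk' : k₁ = k₀ := by simpa [h, sub_eq_zero, eq_comm] using hm2
      rw [hk']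
      split_ifs <;> simp [hτ s, h]
    · obtain rfl : m = -1 := by rw [h] at hm; omega
      rw [h] at hm2
      rcases h2 k₀ with rfl | rfl <;> rcases h2 k₁ with rfl | rfl
      · simp at hm2
      · simp [hτ s, h]
      · simp [hτ s, h]
      · exact absurd hm2 (by decide)
  refine hℓ (ℓ.isTrivial_of_forall_path γ fun S => ?_)
  have h := hγ ⟨fun a => (S (affineSimplex ![0, 1] a)).proj,
    ℓ.isCoveringMap.continuous.comp (S.comp (affineSimplex ![0, 1])).continuous⟩
    ⟨fun a => (S (affineSimplex ![0, 1] a)).2, (S.comp (affineSimplex ![0, 1])).continuous⟩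
  change γ (S (affineSimplex _ _)).proj (S (affineSimplex _ _)).2 =
    γ (S (affineSimplex _ _)).proj (S (affineSimplex _ _)).2 at h
  rwa [affineSimplex_vertex, affineSimplex_vertex] at h

end Orientation

end GroupBundle

end

/-! ### Twisted homology and cohomology when `H₁(X; ℤ/2) ≅ ℤ/2` -/

/-- A compact manifold `X`, with or without boundary, with `H₁(X; ℤ/2) ≅ ℤ/2`, and a non-trivial
bundle `ℓ` of infinite cyclic groups over it: `H₁(X; ℓ)` is finite of odd order, and `H²(X; ℓ)`
has no 2-torsion. -/
theorem proposition2p1 (n : ℕ) (X : Type u) [TopologicalSpace X] [T2Space X]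
    [SecondCountableTopology X] [CompactSpace X] [ChartedSpace (ClosedHalfSpace n) X]
    (hX : Nonempty (modTwoHomology 1 X ≃+ ZMod 2))
    (ℓ : GroupBundle ℤ X) (hℓ : ¬ ℓ.IsTrivial) :
    (Finite (ℓ.homology 1) ∧ Odd (Nat.card (ℓ.homology 1))) ∧
      ∀ x : ℓ.cohomology 2, 2 • x = 0 → x = 0 := by
  have hconv : Convex ℝ {x : EuclideanSpace ℝ (Fin n) | ∀ i : Fin n, i.val = 0 → 0 ≤ x i} := by
    intro x hx y hy a b ha hb _ i hi
    have h1 := hx i hi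
    have h2 := hy i hi
    simp only [PiLp.add_apply, PiLp.smul_apply, smul_eq_mul]
    positivity
  have : LocallyPathConnectedSpace (ClosedHalfSpace n) := hconv.locallyPathConnectedSpace
  have : LocallyPathConnectedSpace X :=
    ChartedSpace.locallyPathConnectedSpace (ClosedHalfSpace n) X
  obtain ⟨z₀, y₀, hz₀, hWz₀⟩ := ℓ.exists_odd_whitneyCocycle hℓ
  have hU := ℓ.boundary_mod_two_of_modTwoHomology_equiv hX
  have hd := ℓ.boundary_boundary 0
  constructor
  · have := ℓ.finite_homology_one (ℓ.exists_isPotential (n := n))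
    refine finite_and_odd_card_of_two_smul_surjective fun a => ?_
    obtain ⟨π, hπ, hπ0⟩ := ℓ.exists_cycles_to_homology 0
    obtain ⟨⟨z, hz⟩, rfl⟩ := hπ a
    obtain ⟨t, x, hx, htx⟩ := exists_cycle_two_smul hd hU ℓ.generatorHom_boundary hz₀ hWz₀ hz
    refine ⟨π ⟨x, hx⟩, ?_⟩
    rw [← sub_eq_zero, ← map_nsmul, ← map_sub]
    exact (hπ0 _).2 ⟨t, (sub_eq_of_eq_add htx).symm⟩
  · intro x hx
    obtain ⟨π, hπ, hπ0⟩ := ℓ.exists_cocycles_to_cohomology 1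
    obtain ⟨⟨φ, hφ⟩, rfl⟩ := hπ x
    rw [← map_nsmul] at hx
    obtain ⟨y, hy⟩ := (hπ0 _).1 hx
    have hy' : ℓ.coboundary 1 y = 2 • φ := hy
    obtain ⟨ζ, hζ⟩ := exists_eq_comp_of_two_mul_eq hd hU ℓ.generatorHom_boundary hz₀ hWz₀
      ℓ.exists_lift_zmod_two (x := ℓ.pairing φ) (y := ℓ.pairing y) fun t => by
        rw [← ℓ.pairing_coboundary, hy', map_nsmul, AddMonoidHom.nsmul_apply, nsmul_eq_mul]
        rfl
    obtain ⟨ψ, rfl⟩ := ℓ.pairing_surjective ζ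
    refine (hπ0 _).2 ⟨ψ, ℓ.pairing_injective (AddMonoidHom.ext fun t => ?_)⟩
    rw [ℓ.pairing_coboundary, ← hζ]
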